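/- Let $T>0$ and let $\lambda\in C^1([0,1]\times[0,\infty))$ with $\lambda>0$. For $\rho_0\in L^\infty(0,1)$ and $u\in L^\infty(0,T)$, both nonnegative almost everywhere, consider the Cauchy problem $$\rho_t(t,x)+\big(\rho(t,x)\,\lambda(x,W(t))\big)_x=0,\qquad W(t)=\int_0^1\rho(t,x)\,dx,\qquad \rho(0,x)=\rho_0(x),\qquad \rho(t,0)\lambda(0,W(t))=u(t),$$ for $0\le t\le T$, $0\le x\le 1$. A weak solution is a function $\rho\in C^0([0,T];L^1(0,1))\cap L^\infty((0,T)\times(0,1))$ with $W(t)\ge 0$ on $[0,T]$ such that for every $\tau\in[0,T]$ and every $\varphi\in C^1([0,\tau]\times[0,1])$ with $\varphi(\tau,\cdot)=0$ and $\varphi(\cdot,1)=0$, $$\int_0^\tau\!\!\int_0^1\rho\,\big(\varphi_t+\lambda(x,W(t))\varphi_x\big)\,dx\,dt+\int_0^\tau u(t)\varphi(t,0)\,dt+\int_0^1\rho_0(x)\varphi(0,x)\,dx=0 .$$ The out-flux of $\rho$ is $y(t)=\rho(t,1)\lambda(1,W(t))$, $t\in(0,T)$, where $\rho(\cdot,1)$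 is the value at $x=1$ of the representative of $\rho$ in $\bigcap_{1\le p<\infty}C^0([0,1];L^p(0,T))$ (as a function of $x$). Theorem. Fix $\lambda$, $T$ and nonnegative data $\rho_0\in L^\infty(0,1)$, $u\in L^\infty(0,T)$. For every $\varepsilon>0$, every $p\in[1,\infty)$ and every $K$ with $\|\rho_0\|_{L^\infty(0,1)}+\|u\|_{L^\infty(0,T)}\le K$ there exists $\eta>0$ such that the following holds for all nonnegative data $\bar\rho_0\in L^\infty(0,1)$, $\bar u\in L^\infty(0,T)$ with $\|\bar\rho_0\|_{L^\infty(0,1)}+\|\bar u\|_{L^\infty(0,T)}\le K$: if $$\|\bar\rho_0-\rho_0\|_{L^p(0,1)}+\|\bar u-u\|_{L^p(0,T)}<\eta ,$$ and $\rho$, $\bar\rho$ are weak solutions for the data $(\rho_0,u)$, $(\bar\rho_0,\bar u)$, then their out-fluxes $y$, $\bar y$ exist and $$\|\bar y-y\|_{L^p(0,T)}<\varepsilon .$$ The number $\eta$ does not depend on $(\bar\rho_0,\bar u)$. -/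

import Mathlib

open MeasureTheory Set Filter Topology
open scoped ENNReal NNReal

/-- Lebesgue measure on the interval `(0, a)`. -/
noncomputable def volIoo (a : ℝ) : Measure ℝ := volume.restrict (Ioo 0 a)

/-- The total mass `W(t) = ∫₀¹ ρ(t,x) dx`. -/
noncomputable def totalMass (ρ : ℝ → ℝ → ℝ) (t : ℝ) : ℝ := ∫ x in (0 : ℝ)..1, ρ t x

/-- Admissible velocities: `λ ∈ C¹([0,1] × [0,∞))` and `λ > 0` there. The values of `lam`
outside `[0,1] × [0,∞)` play no role. -/
structure IsVelocity (lam : ℝ → ℝ → ℝ) : Prop where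
  contDiffOn : ContDiffOn ℝ 1 (fun q : ℝ × ℝ => lam q.1 q.2) (Icc 0 1 ×ˢ Ici 0)
  pos : ∀ x ∈ Icc (0 : ℝ) 1, ∀ w ∈ Ici (0 : ℝ), 0 < lam x w

/-- `f ∈ L^∞_+(0,a)`: measurable, essentially bounded and nonnegative almost everywhere. -/
structure MemLInftyPlus (a : ℝ) (f : ℝ → ℝ) : Prop where
  memLp : MemLp f ∞ (volIoo a)
  nonneg : ∀ᵐ s ∂(volIoo a), 0 ≤ f s

/-- Test functions `φ ∈ C¹([0,τ] × [0,1])` with `φ(τ,x) = 0` for `x ∈ [0,1]` and `φ(t,1) = 0` for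
`t ∈ [0,τ]`. -/
structure IsTestFunction (τ : ℝ) (φ : ℝ → ℝ → ℝ) : Prop where
  contDiffOn : ContDiffOn ℝ 1 (fun q : ℝ × ℝ => φ q.1 q.2) (Icc 0 τ ×ˢ Icc 0 1)
  final : ∀ x ∈ Icc (0 : ℝ) 1, φ τ x = 0
  right : ∀ t ∈ Icc (0 : ℝ) τ, φ t 1 = 0

/-- Weak solutions `ρ ∈ C⁰([0,T]; L¹(0,1)) ∩ L^∞((0,T) × (0,1))` of
`ρ_t + (ρ λ(x,W(t)))_x = 0`, `ρ(0,x) = ρ₀(x)`, `ρ(t,0) λ(0,W(t)) = u(t)`. -/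
structure IsWeakSolution (lam : ℝ → ℝ → ℝ) (T : ℝ) (ρ₀ u : ℝ → ℝ) (ρ : ℝ → ℝ → ℝ) : Prop where
  memLp_one : ∀ t ∈ Icc (0 : ℝ) T, MemLp (ρ t) 1 (volIoo 1)
  continuous_L1 : ∀ s ∈ Icc (0 : ℝ) T,
    Tendsto (fun t => eLpNorm (fun x => ρ t x - ρ s x) 1 (volIoo 1)) (𝓝[Icc 0 T] s) (𝓝 0)
  memLp_top : MemLp (fun q : ℝ × ℝ => ρ q.1 q.2) ∞ (volume.restrict (Ioo 0 T ×ˢ Ioo 0 1))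
  /-- The velocity is defined on `[0,1] × [0,∞)` only, so `λ(x,W(t))` needs `W(t) ≥ 0`. -/
  mass_nonneg : ∀ t ∈ Icc (0 : ℝ) T, 0 ≤ totalMass ρ t
  weak : ∀ τ ∈ Icc (0 : ℝ) T, ∀ φ : ℝ → ℝ → ℝ, IsTestFunction τ φ →
    (∫ t in (0 : ℝ)..τ, ∫ x in (0 : ℝ)..1,
        ρ t x * (derivWithin (fun s => φ s x) (Icc 0 τ) t
          + lam x (totalMass ρ t) * derivWithin (fun z => φ t z) (Icc 0 1) x))
      + (∫ t in (0 : ℝ)..τ, u t * φ t 0)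
      + (∫ x in (0 : ℝ)..1, ρ₀ x * φ 0 x) = 0

/-- `r` is a representative of `ρ` (as a function on `(0,T) × (0,1)` up to null sets) that belongs
to `C⁰([0,1]; L^p(0,T))`, as a function of `x`, for every `p ∈ [1,∞)`. -/
structure IsSpaceContinuousRep (T : ℝ) (ρ r : ℝ → ℝ → ℝ) : Prop where
  ae_eq : (fun q : ℝ × ℝ => r q.1 q.2)
    =ᵐ[volume.restrict (Ioo 0 T ×ˢ Ioo 0 1)] (fun q : ℝ × ℝ => ρ q.1 q.2)
  memLp : ∀ p : ℝ≥0∞, 1 ≤ p → p ≠ ∞ → ∀ x ∈ Icc (0 : ℝ) 1, MemLp (fun t => r t x) p (volIoo T)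
  continuous_Lp : ∀ p : ℝ≥0∞, 1 ≤ p → p ≠ ∞ → ∀ x ∈ Icc (0 : ℝ) 1,
    Tendsto (fun z => eLpNorm (fun t => r t z - r t x) p (volIoo T)) (𝓝[Icc 0 1] x) (𝓝 0)

/-- `y` is the out-flux `y(t) = ρ(t,1) λ(1,W(t))`, `t ∈ (0,T)` (up to a null set), where `ρ(·,1)`
is the value at `x = 1` of the continuous function `x ↦ ρ(·,x) ∈ L^p(0,T)`. -/
def IsOutflux (lam : ℝ → ℝ → ℝ) (T : ℝ) (ρ : ℝ → ℝ → ℝ) (y : ℝ → ℝ) : Prop :=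
  ∃ r : ℝ → ℝ → ℝ, IsSpaceContinuousRep T ρ r ∧
    ∀ᵐ t ∂(volIoo T), y t = r t 1 * lam 1 (totalMass ρ t)

/-!
The velocity is replaced by a bounded, Lipschitz and strictly positive velocity on the whole plane
that agrees with it for `x ∈ [0, 1]` and the masses in question, so that characteristics exist for
all times and cross each line `x = const` once. Testing the equation with smoothed indicators of the
region to the left of a characteristic shows that the mass in `[0, x]` at time `t` is the initial
mass to the left of the foot of the characteristic through `(t, x)` plus the influx since its entry
time. Differentiating in `x` gives a formula for `ρ` in terms of the data and of the mass path `W`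
alone; it is continuous in `x` with values in `Lᵖ(0, T)`, so its trace at `x = 1` gives the
out-flux, and taking `x = 1` in the integrated identity bounds `W` by the data.

The same identity and Gronwall's inequality bound the difference of two mass paths by the `L¹`
distance of the data. When the data converge, the feet and entry times therefore converge
pointwise. They are uniformly anti-Lipschitz, so composition with them is continuous in `L¹`, and
the out-fluxes converge in `L¹`, hence in `Lᵖ`, as they are uniformly bounded. Since the mass path
and the out-flux are determined by the data, this sequential continuity gives `η` by contradiction.
-/

section Gronwall

variable {f : ℝ → ℝ} {A C a b : ℝ}

theorem le_mul_exp_of_le_add_mul_integral (hf : Continuous f) (hC : 0 ≤ C) (hab : a ≤ b)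
    (h : ∀ r ∈ Icc a b, f r ≤ A + C * ∫ s in a..r, f s) :
    f b ≤ A * Real.exp (C * (b - a)) := by
  have hderiv : ∀ r, HasDerivAt (fun r => A + C * ∫ s in a..r, f s) (C * f r) r := fun r =>
    ((hf.integral_hasStrictDerivAt a r).hasDerivAt.const_mul C).const_add A
  have hbound := le_gronwallBound_of_liminf_deriv_right_le (δ := A) (K := C) (ε := 0)
    (fun r _ => (hderiv r).continuousAt.continuousWithinAt)
    (fun r _ _ hr => (hderiv r).hasDerivWithinAt.liminf_right_slope_le hr) (by simp)
    (fun r hr => by simpa using mul_le_mul_of_nonneg_left (h r (Ico_subset_Icc_self hr)) hC)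
    b (right_mem_Icc.2 hab)
  rw [gronwallBound_ε0] at hbound
  exact (h b (right_mem_Icc.2 hab)).trans hbound

theorem le_mul_exp_abs_of_le_add_mul_abs_integral (hf : Continuous f) (hf0 : ∀ r, 0 ≤ f r)
    (hC : 0 ≤ C) (h : ∀ r ∈ uIcc a b, f r ≤ A + C * |∫ s in a..r, f s|) :
    f b ≤ A * Real.exp (C * |b - a|) := by
  rcases le_total a b with hab | hab
  · rw [abs_of_nonneg (sub_nonneg.2 hab)]
    refine le_mul_exp_of_le_add_mul_integral hf hC hab fun r hr => ?_
    have hr' := h r (by rwa [uIcc_of_le hab])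
    rwa [abs_of_nonneg (intervalIntegral.integral_nonneg hr.1 fun s _ => hf0 s)] at hr'
  · have reflected := le_mul_exp_of_le_add_mul_integral (f := fun r => f (-r)) (A := A)
      (hf.comp continuous_neg) hC (neg_le_neg hab) fun r hr => ?_
    · rw [abs_of_nonpos (sub_nonpos.2 hab)]
      simpa only [neg_neg, neg_sub, sub_neg_eq_add, neg_add_eq_sub] using reflected
    · have hr' : -r ∈ Icc b a := ⟨by linarith [hr.2], by linarith [hr.1]⟩
      have hfr := h (-r) (by rwa [uIcc_of_ge hab])
      rw [intervalIntegral.integral_symm, abs_neg,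
        abs_of_nonneg (intervalIntegral.integral_nonneg hr'.2 fun s _ => hf0 s)] at hfr
      rwa [intervalIntegral.integral_comp_neg, neg_neg]

end Gronwall

theorem map_restrict_le_of_antilipschitzWith {A : Set ℝ} (hA : MeasurableSet A) {S : ℝ → ℝ}
    (hSm : Measurable S) {C : ℝ≥0} (hS : AntilipschitzWith C (A.domRestrict S)) :
    (volume.restrict A).map S ≤ C • volume := by
  refine Measure.le_iff.2 fun s hs => ?_
  have hpre : ((↑) : A → ℝ) '' (A.domRestrict S ⁻¹' s) = S ⁻¹' s ∩ A := by
    ext x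
    simp [Set.domRestrict, and_comm]
  rw [Measure.map_apply hSm hs, Measure.restrict_apply' hA, ← hpre, ← hausdorffMeasure_real,
    isometry_subtype_coe.hausdorffMeasure_image (Or.inl zero_le_one)]
  simpa using hS.hausdorffMeasure_preimage_le zero_le_one s

section Convergence

variable {α ι : Type*} [MeasurableSpace α] {μ : Measure α} {l : Filter ι}

theorem tendsto_eLpNorm_one_of_dominated [l.IsCountablyGenerated] {F : ι → α → ℝ} {f bound : α → ℝ}
    (hbound : Integrable bound μ) (hF : ∀ n, AEStronglyMeasurable (F n) μ)
    (hf : AEStronglyMeasurable f μ) (hle : ∀ᶠ n in l, ∀ᵐ x ∂μ, |(F n - f) x| ≤ bound x)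
    (hlim : ∀ᵐ x ∂μ, Tendsto (fun n => F n x) l (𝓝 (f x))) :
    Tendsto (fun n => eLpNorm (F n - f) 1 μ) l (𝓝 0) := by
  have hconv := tendsto_lintegral_filter_of_dominated_convergence' (μ := μ) (l := l)
    (f := fun _ => 0) (fun x => ‖bound x‖ₑ)
    (Eventually.of_forall fun n => ((hF n).sub hf).enorm) ?_ hbound.2.ne ?_
  · simpa [eLpNorm_one_eq_lintegral_enorm] using hconv
  · filter_upwards [hle] with n hn
    filter_upwards [hn] with x hx
    exact enorm_le_iff_norm_le.2 (hx.trans (le_abs_self _))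
  · filter_upwards [hlim] with x hx
    simpa using (hx.sub_const (f x)).enorm

theorem tendsto_eLpNorm_one_mul_sub [l.IsCountablyGenerated] {a f : ι → α → ℝ} {a₀ f₀ : α → ℝ}
    {M : ℝ≥0} (ham : ∀ n, AEStronglyMeasurable (a n) μ) (ha₀m : AEStronglyMeasurable a₀ μ)
    (ha : ∀ n, ∀ᵐ x ∂μ, |a n x| ≤ M) (ha₀ : ∀ᵐ x ∂μ, |a₀ x| ≤ M)
    (halim : ∀ᵐ x ∂μ, Tendsto (fun n => a n x) l (𝓝 (a₀ x)))
    (hfm : ∀ n, AEStronglyMeasurable (f n) μ) (hf₀ : Integrable f₀ μ)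
    (hflim : Tendsto (fun n => eLpNorm (f n - f₀) 1 μ) l (𝓝 0)) :
    Tendsto (fun n => eLpNorm (a n * f n - a₀ * f₀) 1 μ) l (𝓝 0) := by
  have hcoeff : Tendsto (fun n => eLpNorm (a n * f₀ - a₀ * f₀) 1 μ) l (𝓝 0) := by
    refine tendsto_eLpNorm_one_of_dominated (hf₀.abs.const_mul (M + M)) (fun n => (ham n).mul hf₀.1)
      (ha₀m.mul hf₀.1) (Eventually.of_forall fun n => ?_) ?_
    · filter_upwards [ha n, ha₀] with x hx hx₀
      simp only [Pi.sub_apply, Pi.mul_apply, ← sub_mul, abs_mul]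
      gcongr
      exact (abs_sub _ _).trans (add_le_add hx hx₀)
    · filter_upwards [halim] with x hx using hx.mul_const _
  have hmul : Tendsto (fun n => eLpNorm (a n * (f n - f₀)) 1 μ) l (𝓝 0) := by
    have hM := ENNReal.Tendsto.const_mul (a := (M : ℝ≥0∞)) hflim (Or.inr ENNReal.coe_ne_top)
    rw [mul_zero] at hM
    refine tendsto_of_tendsto_of_tendsto_of_le_of_le tendsto_const_nhds hM (fun _ => bot_le)
      fun n => eLpNorm_le_nnreal_smul_eLpNorm_of_ae_le_mul ?_ 1
    filter_upwards [ha n] with x hx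
    rw [Pi.mul_apply, nnnorm_mul]
    gcongr
    exact_mod_cast hx
  have hsum := hmul.add hcoeff
  rw [add_zero] at hsum
  refine tendsto_of_tendsto_of_tendsto_of_le_of_le tendsto_const_nhds hsum (fun _ => bot_le)
    fun n => ?_
  have hsplit : a n * f n - a₀ * f₀ = a n * (f n - f₀) + (a n * f₀ - a₀ * f₀) := by ring
  rw [hsplit]
  exact eLpNorm_add_le ((ham n).mul ((hfm n).sub hf₀.1))
    (((ham n).mul hf₀.1).sub (ha₀m.mul hf₀.1)) le_rfl

theorem eLpNorm_le_of_ae_abs_le {f : α → ℝ} {M : ℝ≥0} (hM : ∀ᵐ x ∂μ, |f x| ≤ M) {p : ℝ≥0∞}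
    (hp : 1 ≤ p) (hp' : p ≠ ∞) :
    eLpNorm f p μ ≤ ((M : ℝ≥0∞) ^ (p.toReal - 1) * eLpNorm f 1 μ) ^ (1 / p.toReal) := by
  have hp1 : 1 ≤ p.toReal := by simpa using ENNReal.toReal_mono hp' hp
  rw [eLpNorm_eq_lintegral_rpow_enorm_toReal (by positivity) hp', eLpNorm_one_eq_lintegral_enorm]
  refine ENNReal.rpow_le_rpow ?_ (by positivity)
  rw [← lintegral_const_mul' _ _ (ENNReal.rpow_ne_top_of_nonneg (by linarith) ENNReal.coe_ne_top)]
  refine lintegral_mono_ae ?_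
  filter_upwards [hM] with x hx
  have hxM : ‖f x‖ₑ ≤ M := enorm_le_coe.2 (by exact_mod_cast hx)
  calc ‖f x‖ₑ ^ p.toReal = ‖f x‖ₑ ^ (p.toReal - 1 + 1) := by ring_nf
    _ = ‖f x‖ₑ ^ (p.toReal - 1) * ‖f x‖ₑ := by
        rw [ENNReal.rpow_add_of_nonneg _ _ (by linarith) zero_le_one, ENNReal.rpow_one]
    _ ≤ _ := by gcongr

theorem tendsto_eLpNorm_of_ae_abs_le {f : ι → α → ℝ} {M : ℝ≥0}
    (hM : ∀ᶠ n in l, ∀ᵐ x ∂μ, |f n x| ≤ M) {p : ℝ≥0∞} (hp : 1 ≤ p) (hp' : p ≠ ∞)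
    (hf : Tendsto (fun n => eLpNorm (f n) 1 μ) l (𝓝 0)) :
    Tendsto (fun n => eLpNorm (f n) p μ) l (𝓝 0) := by
  have hp1 : 1 ≤ p.toReal := by simpa using ENNReal.toReal_mono hp' hp
  have hlim := (ENNReal.continuous_rpow_const (y := 1 / p.toReal)).continuousAt.tendsto.comp
    (ENNReal.Tendsto.const_mul (a := (M : ℝ≥0∞) ^ (p.toReal - 1)) hf
      (Or.inr (ENNReal.rpow_ne_top_of_nonneg (by linarith) ENNReal.coe_ne_top)))
  rw [mul_zero, ENNReal.zero_rpow_of_pos (by positivity)] at hlim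
  refine tendsto_of_tendsto_of_tendsto_of_le_of_le' tendsto_const_nhds hlim
    (Eventually.of_forall fun _ => bot_le) ?_
  filter_upwards [hM] with n hn using eLpNorm_le_of_ae_abs_le hn hp hp'

theorem tendsto_eLpNorm_one_of_tendsto_eLpNorm [IsFiniteMeasure μ] {f : ι → α → ℝ}
    (hfm : ∀ n, AEStronglyMeasurable (f n) μ) {p : ℝ≥0∞} (hp : 1 ≤ p)
    (hf : Tendsto (fun n => eLpNorm (f n) p μ) l (𝓝 0)) :
    Tendsto (fun n => eLpNorm (f n) 1 μ) l (𝓝 0) := by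
  rcases eq_or_ne μ 0 with rfl | hμ
  · simpa using tendsto_const_nhds
  have hexp : μ univ ^ (1 / (1 : ℝ≥0∞).toReal - 1 / p.toReal) ≠ ∞ :=
    ENNReal.rpow_ne_top_of_ne_zero (Measure.measure_univ_ne_zero.2 hμ) (measure_ne_top μ univ)
  have hlim := ENNReal.Tendsto.mul_const hf (Or.inr hexp)
  rw [zero_mul] at hlim
  exact tendsto_of_tendsto_of_tendsto_of_le_of_le tendsto_const_nhds hlim (fun _ => bot_le)
    fun n => eLpNorm_le_eLpNorm_mul_rpow_measure_univ hp (hfm n)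

end Convergence

section Composition

variable {α β ι : Type*} [MeasurableSpace α] [MeasurableSpace β] {μ : Measure α} {ν : Measure β}
  {C : ℝ≥0}

theorem quasiMeasurePreserving_of_map_le {S : α → β} (hS : Measurable S) (hle : μ.map S ≤ C • ν) :
    Measure.QuasiMeasurePreserving S μ ν :=
  ⟨hS, hle.absolutelyContinuous.trans (Measure.smul_absolutelyContinuous)⟩

theorem eLpNorm_one_comp_le {S : α → β} (hS : Measurable S) (hle : μ.map S ≤ C • ν) {f : β → ℝ}
    (hf : AEStronglyMeasurable f ν) : eLpNorm (f ∘ S) 1 μ ≤ C * eLpNorm f 1 ν := by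
  have hac := (quasiMeasurePreserving_of_map_le hS hle).absolutelyContinuous
  rw [← eLpNorm_map_measure (hf.mono_ac hac) hS.aemeasurable]
  refine (eLpNorm_mono_measure f hle).trans ?_
  rw [eLpNorm_smul_measure_of_ne_top' ENNReal.one_ne_top, ENNReal.toReal_one, inv_one,
    NNReal.rpow_one, ENNReal.smul_def, smul_eq_mul]

theorem integrable_comp_of_map_le {S : α → β} (hS : Measurable S) (hle : μ.map S ≤ C • ν)
    {f : β → ℝ} (hf : Integrable f ν) : Integrable (f ∘ S) μ :=
  ((hf.smul_measure_nnreal (c := C)).mono_measure hle).comp_measurable hS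

variable [TopologicalSpace β] [BorelSpace β] [IsFiniteMeasure μ] {l : Filter ι}
  [l.IsCountablyGenerated] {S : ι → α → β} {S₀ : α → β}

theorem tendsto_eLpNorm_comp_sub_of_hasCompactSupport {h : β → ℝ} (hh : Continuous h)
    (hsupp : HasCompactSupport h) (hS : ∀ n, Measurable (S n)) (hS₀ : Measurable S₀)
    (hSlim : ∀ᵐ x ∂μ, Tendsto (fun n => S n x) l (𝓝 (S₀ x))) :
    Tendsto (fun n => eLpNorm (h ∘ S n - h ∘ S₀) 1 μ) l (𝓝 0) := by
  obtain ⟨M, hM⟩ := hh.bounded_above_of_compact_support hsupp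
  refine tendsto_eLpNorm_one_of_dominated (integrable_const (M + M))
    (fun n => (hh.measurable.comp (hS n)).aestronglyMeasurable)
    (hh.measurable.comp hS₀).aestronglyMeasurable
    (Eventually.of_forall fun n => Eventually.of_forall fun x =>
      (abs_sub _ _).trans (add_le_add (hM _) (hM _))) ?_
  filter_upwards [hSlim] with x hx using (hh.tendsto _).comp hx

variable [R1Space β] [NormalSpace β] [WeaklyLocallyCompactSpace β] [ν.Regular]

theorem tendsto_eLpNorm_comp_sub_of_integrable {f : β → ℝ} (hf : Integrable f ν)
    (hS : ∀ n, Measurable (S n)) (hS₀ : Measurable S₀) (hSle : ∀ n, μ.map (S n) ≤ C • ν)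
    (hS₀le : μ.map S₀ ≤ C • ν) (hSlim : ∀ᵐ x ∂μ, Tendsto (fun n => S n x) l (𝓝 (S₀ x))) :
    Tendsto (fun n => eLpNorm (f ∘ S n - f ∘ S₀) 1 μ) l (𝓝 0) := by
  rw [ENNReal.tendsto_nhds_zero]
  intro ε hε
  obtain ⟨δ, hδ, hCδ⟩ := ENNReal.exists_nnreal_pos_mul_lt (a := C) ENNReal.coe_ne_top
    (b := ε / 3) (by simpa using hε.ne')
  obtain ⟨h, hsupp, hfh, hh, hhL1⟩ :=
    (memLp_one_iff_integrable.2 hf).exists_hasCompactSupport_eLpNorm_sub_le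
      ENNReal.one_ne_top (ENNReal.coe_ne_zero.2 hδ.ne')
  have hfhm : AEStronglyMeasurable (f - h) ν := hf.1.sub hhL1.1
  have happrox : ∀ {S' : α → β}, Measurable S' → μ.map S' ≤ C • ν →
      AEStronglyMeasurable ((f - h) ∘ S') μ ∧ eLpNorm ((f - h) ∘ S') 1 μ ≤ ε / 3 :=
    fun hS' hle => ⟨hfhm.comp_quasiMeasurePreserving (quasiMeasurePreserving_of_map_le hS' hle),
      (eLpNorm_one_comp_le hS' hle hfhm).trans
        ((mul_le_mul_right hfh _).trans (by rw [mul_comm]; exact hCδ.le))⟩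
  obtain ⟨hm₀, hle₀⟩ := happrox hS₀ hS₀le
  filter_upwards [ENNReal.tendsto_nhds_zero.1 (tendsto_eLpNorm_comp_sub_of_hasCompactSupport hh
    hsupp hS hS₀ hSlim) (ε / 3) (by simpa using hε.ne')] with n hn
  obtain ⟨hm, hle⟩ := happrox (hS n) (hSle n)
  have hhm : AEStronglyMeasurable (h ∘ S n - h ∘ S₀) μ :=
    ((hh.measurable.comp (hS n)).sub (hh.measurable.comp hS₀)).aestronglyMeasurable
  calc eLpNorm (f ∘ S n - f ∘ S₀) 1 μ
      = eLpNorm ((f - h) ∘ S n + (h ∘ S n - h ∘ S₀) - (f - h) ∘ S₀) 1 μ := by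
        congr 1
        ext x
        simp
    _ ≤ eLpNorm ((f - h) ∘ S n) 1 μ + eLpNorm (h ∘ S n - h ∘ S₀) 1 μ
          + eLpNorm ((f - h) ∘ S₀) 1 μ :=
        (eLpNorm_sub_le (hm.add hhm) hm₀ le_rfl).trans
          (add_le_add_left (eLpNorm_add_le hm hhm le_rfl) _)
    _ ≤ ε / 3 + ε / 3 + ε / 3 := by gcongr
    _ = ε := ENNReal.add_thirds ε

theorem tendsto_eLpNorm_comp_sub {f : ι → β → ℝ} {f₀ : β → ℝ}
    (hfm : ∀ n, AEStronglyMeasurable (f n) ν) (hf₀ : Integrable f₀ ν)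
    (hflim : Tendsto (fun n => eLpNorm (f n - f₀) 1 ν) l (𝓝 0)) (hS : ∀ n, Measurable (S n))
    (hS₀ : Measurable S₀) (hSle : ∀ n, μ.map (S n) ≤ C • ν) (hS₀le : μ.map S₀ ≤ C • ν)
    (hSlim : ∀ᵐ x ∂μ, Tendsto (fun n => S n x) l (𝓝 (S₀ x))) :
    Tendsto (fun n => eLpNorm (f n ∘ S n - f₀ ∘ S₀) 1 μ) l (𝓝 0) := by
  have hlim := (ENNReal.Tendsto.const_mul (a := (C : ℝ≥0∞)) hflim (Or.inr ENNReal.coe_ne_top)).add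
    (tendsto_eLpNorm_comp_sub_of_integrable hf₀ hS hS₀ hSle hS₀le hSlim)
  rw [mul_zero, add_zero] at hlim
  refine tendsto_of_tendsto_of_tendsto_of_le_of_le tendsto_const_nhds hlim (fun _ => bot_le)
    fun n => ?_
  have hq := quasiMeasurePreserving_of_map_le (hS n) (hSle n)
  have hq₀ := quasiMeasurePreserving_of_map_le hS₀ hS₀le
  have hsplit : f n ∘ S n - f₀ ∘ S₀ = (f n - f₀) ∘ S n + (f₀ ∘ S n - f₀ ∘ S₀) := by
    ext x
    simp
  rw [hsplit]
  refine (eLpNorm_add_le (((hfm n).sub hf₀.1).comp_quasiMeasurePreserving hq)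
    ((hf₀.1.comp_quasiMeasurePreserving hq).sub (hf₀.1.comp_quasiMeasurePreserving hq₀))
    le_rfl).trans ?_
  gcongr
  exact eLpNorm_one_comp_le (hS n) (hSle n) ((hfm n).sub hf₀.1)

theorem tendsto_eLpNorm_one_mul_comp_sub {a : ι → α → ℝ} {a₀ : α → ℝ} {f : ι → β → ℝ} {f₀ : β → ℝ}
    {M : ℝ≥0} (ham : ∀ n, AEStronglyMeasurable (a n) μ) (ha₀m : AEStronglyMeasurable a₀ μ)
    (ha : ∀ n, ∀ᵐ x ∂μ, |a n x| ≤ M) (ha₀ : ∀ᵐ x ∂μ, |a₀ x| ≤ M)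
    (halim : ∀ᵐ x ∂μ, Tendsto (fun n => a n x) l (𝓝 (a₀ x)))
    (hfm : ∀ n, AEStronglyMeasurable (f n) ν) (hf₀ : Integrable f₀ ν)
    (hflim : Tendsto (fun n => eLpNorm (f n - f₀) 1 ν) l (𝓝 0)) (hS : ∀ n, Measurable (S n))
    (hS₀ : Measurable S₀) (hSle : ∀ n, μ.map (S n) ≤ C • ν) (hS₀le : μ.map S₀ ≤ C • ν)
    (hSlim : ∀ᵐ x ∂μ, Tendsto (fun n => S n x) l (𝓝 (S₀ x))) :
    Tendsto (fun n => eLpNorm (a n * (f n ∘ S n) - a₀ * (f₀ ∘ S₀)) 1 μ) l (𝓝 0) :=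
  tendsto_eLpNorm_one_mul_sub ham ha₀m ha ha₀ halim
    (fun n => (hfm n).comp_quasiMeasurePreserving
      (quasiMeasurePreserving_of_map_le (hS n) (hSle n)))
    (integrable_comp_of_map_le hS₀ hS₀le hf₀)
    (tendsto_eLpNorm_comp_sub hfm hf₀ hflim hS hS₀ hSle hS₀le hSlim)

end Composition

section GlobalExistence

variable {E : Type*} [NormedAddCommGroup E] [NormedSpace ℝ E] {v : ℝ → E → E} {K Λ : ℝ≥0}

theorem exists_eq_forall_mem_Ioo_hasDerivAt [CompleteSpace E] (hlip : ∀ s, LipschitzWith K (v s))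
    (hcont : ∀ x, Continuous fun s => v s x) (hbound : ∀ s x, ‖v s x‖ ≤ Λ) (t : ℝ) (x : E)
    (r : ℝ≥0) : ∃ ξ : ℝ → E, ξ t = x ∧ ∀ s ∈ Ioo (t - r) (t + r), HasDerivAt ξ (v s (ξ s)) s := by
  have := r.2
  have hPL : IsPicardLindelof v (tmin := t - r) (tmax := t + r)
      ⟨t, by constructor <;> linarith⟩ x (Λ * r) 0 Λ K :=
    ⟨fun s _ => (hlip s).lipschitzOnWith, fun y _ => (hcont y).continuousOn,
      fun s _ y _ => hbound s y, by simp⟩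
  obtain ⟨ξ, hξt, hξ⟩ := hPL.exists_eq_forall_mem_Icc_hasDerivWithinAt₀
  exact ⟨ξ, hξt, fun s hs => (hξ s (Ioo_subset_Icc_self hs)).hasDerivAt (Icc_mem_nhds hs.1 hs.2)⟩

theorem exists_eq_forall_hasDerivAt_of_forall_mem_Ioo (hlip : ∀ s, LipschitzWith K (v s)) {t : ℝ}
    {x : E} (hloc : ∀ r : ℝ≥0, ∃ ξ : ℝ → E, ξ t = x ∧
      ∀ s ∈ Ioo (t - r) (t + r), HasDerivAt ξ (v s (ξ s)) s) :
    ∃ ξ : ℝ → E, ξ t = x ∧ ∀ s, HasDerivAt ξ (v s (ξ s)) s := by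
  choose ξ hξt hξ using hloc
  have hmono : ∀ r r' : ℝ≥0, r ≤ r' → EqOn (ξ r) (ξ r') (Ioo (t - r) (t + r)) := by
    intro r r' hrr' s hs
    have : (r : ℝ) ≤ r' := hrr'
    have hsr : t ∈ Ioo (t - (r : ℝ)) (t + r) := by constructor <;> linarith [hs.1, hs.2]
    refine ODE_solution_unique_of_mem_Ioo (s := fun _ => univ)
      (fun s _ => (hlip s).lipschitzOnWith) hsr (fun s hs => ⟨hξ r s hs, mem_univ _⟩)
      (fun s hs => ⟨hξ r' s ⟨?_, ?_⟩, mem_univ _⟩) (by rw [hξt, hξt]) hs <;> linarith [hs.1, hs.2]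
  have hmem : ∀ s, s ∈ Ioo (t - (‖s - t‖₊ + 1 : ℝ≥0)) (t + (‖s - t‖₊ + 1 : ℝ≥0)) := by
    intro s
    have hle := le_abs_self (s - t)
    have hge := neg_abs_le (s - t)
    constructor <;> push_cast <;> rw [Real.norm_eq_abs] <;> linarith
  refine ⟨fun s => ξ (‖s - t‖₊ + 1) s, hξt _, fun s => ?_⟩
  have hagree : (fun r => ξ (‖r - t‖₊ + 1) r) =ᶠ[𝓝 s] ξ (‖s - t‖₊ + 1) := by
    filter_upwards [isOpen_Ioo.mem_nhds (hmem s)] with r hr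
    rcases le_total (‖r - t‖₊ + 1) (‖s - t‖₊ + 1) with hle | hle
    · exact hmono _ _ hle (hmem r)
    · exact (hmono _ _ hle hr).symm
  exact (hξ _ s (hmem s)).congr_of_eventuallyEq hagree

theorem exists_eq_forall_hasDerivAt [CompleteSpace E] (hlip : ∀ s, LipschitzWith K (v s))
    (hcont : ∀ x, Continuous fun s => v s x) (hbound : ∀ s x, ‖v s x‖ ≤ Λ) (t : ℝ) (x : E) :
    ∃ ξ : ℝ → E, ξ t = x ∧ ∀ s, HasDerivAt ξ (v s (ξ s)) s :=
  exists_eq_forall_hasDerivAt_of_forall_mem_Ioo hlip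
    (exists_eq_forall_mem_Ioo_hasDerivAt hlip hcont hbound t x)

end GlobalExistence

/-- A velocity field `(x, w) ↦ V x w` on the whole plane that is Lipschitz, bounded above and away
from zero, independent of `x` for `x ≤ 0`, and differentiable in `x ∈ (0, 1)` with derivative
`V.deriv`, a bounded continuous function on the plane. An admissible velocity is extended to such a
field, so that characteristics exist for all times and particles can be traced back to `x < 0`. -/
structure RegularVelocity where
  toFun : ℝ → ℝ → ℝ
  deriv : ℝ → ℝ → ℝ
  minSpeed : ℝ
  maxSpeed : ℝ
  lipConst : ℝ
  minSpeed_pos : 0 < minSpeed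
  minSpeed_le : ∀ x w, minSpeed ≤ toFun x w
  le_maxSpeed : ∀ x w, toFun x w ≤ maxSpeed
  abs_sub_le : ∀ x w x' w', |toFun x w - toFun x' w'| ≤ lipConst * (|x - x'| + |w - w'|)
  eq_of_nonpos : ∀ x ≤ 0, ∀ w, toFun x w = toFun 0 w
  hasDerivAt : ∀ x ∈ Ioo (0 : ℝ) 1, ∀ w, HasDerivAt (fun z => toFun z w) (deriv x w) x
  continuous_deriv : Continuous fun q : ℝ × ℝ => deriv q.1 q.2
  abs_deriv_le : ∀ x w, |deriv x w| ≤ lipConst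

namespace RegularVelocity

instance : CoeFun RegularVelocity fun _ => ℝ → ℝ → ℝ := ⟨toFun⟩

variable (V : RegularVelocity)

theorem lipConst_nonneg : 0 ≤ V.lipConst := (abs_nonneg _).trans (V.abs_deriv_le 0 0)

theorem pos (x w : ℝ) : 0 < V x w := V.minSpeed_pos.trans_le (V.minSpeed_le x w)

theorem maxSpeed_pos : 0 < V.maxSpeed := (V.pos 0 0).trans_le (V.le_maxSpeed 0 0)

theorem continuous_uncurry : Continuous fun q : ℝ × ℝ => V q.1 q.2 := by
  refine continuous_iff_continuousAt.2 fun q => tendsto_iff_dist_tendsto_zero.2 ?_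
  have hbound : Continuous fun p : ℝ × ℝ => V.lipConst * (|p.1 - q.1| + |p.2 - q.2|) := by
    fun_prop
  exact squeeze_zero (fun _ => dist_nonneg) (fun p => V.abs_sub_le _ _ _ _)
    (by simpa using hbound.tendsto q)

@[fun_prop]
theorem continuous_comp {α : Type*} [TopologicalSpace α] {f g : α → ℝ} (hf : Continuous f)
    (hg : Continuous g) : Continuous fun a => V (f a) (g a) :=
  V.continuous_uncurry.comp (hf.prodMk hg)

@[fun_prop]
theorem continuous_deriv_comp {α : Type*} [TopologicalSpace α] {f g : α → ℝ} (hf : Continuous f)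
    (hg : Continuous g) : Continuous fun a => V.deriv (f a) (g a) :=
  V.continuous_deriv.comp (hf.prodMk hg)

/-- The velocity at the inlet `x = 0`, extended to all positions. -/
def atInlet : RegularVelocity where
  toFun _ w := V 0 w
  deriv _ _ := 0
  minSpeed := V.minSpeed
  maxSpeed := V.maxSpeed
  lipConst := V.lipConst
  minSpeed_pos := V.minSpeed_pos
  minSpeed_le _ := V.minSpeed_le 0
  le_maxSpeed _ := V.le_maxSpeed 0
  abs_sub_le x w x' w' := (V.abs_sub_le 0 w 0 w').trans <|
    mul_le_mul_of_nonneg_left (by simp) V.lipConst_nonneg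
  eq_of_nonpos _ _ _ := rfl
  hasDerivAt x _ _ := hasDerivAt_const x _
  continuous_deriv := continuous_const
  abs_deriv_le _ _ := by simpa using V.lipConst_nonneg

end RegularVelocity

/-- `ξ` is a characteristic: it moves with the velocity `V` for the total mass `w`. -/
def IsChar (V : RegularVelocity) (w : C(ℝ, ℝ)) (ξ : ℝ → ℝ) : Prop :=
  ∀ s, HasDerivAt ξ (V (ξ s) (w s)) s

namespace IsChar

variable {V : RegularVelocity} {w w₁ w₂ : C(ℝ, ℝ)} {ξ ξ₁ ξ₂ : ℝ → ℝ}

theorem differentiable (hξ : IsChar V w ξ) : Differentiable ℝ ξ :=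
  fun s => (hξ s).differentiableAt

theorem continuous (hξ : IsChar V w ξ) : Continuous ξ := hξ.differentiable.continuous

theorem deriv_eq (hξ : IsChar V w ξ) : deriv ξ = fun s => V (ξ s) (w s) :=
  funext fun s => (hξ s).deriv

theorem continuous_velocity (hξ : IsChar V w ξ) : Continuous fun s => V (ξ s) (w s) :=
  V.continuous_comp hξ.continuous w.continuous

theorem contDiff (hξ : IsChar V w ξ) : ContDiff ℝ 1 ξ :=
  contDiff_one_iff_deriv.2 ⟨hξ.differentiable, hξ.deriv_eq ▸ hξ.continuous_velocity⟩

theorem minSpeed_mul_le (hξ : IsChar V w ξ) {s t : ℝ} (hst : s ≤ t) :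
    V.minSpeed * (t - s) ≤ ξ t - ξ s :=
  mul_sub_le_image_sub_of_le_deriv hξ.differentiable
    (fun s => by rw [hξ.deriv_eq]; exact V.minSpeed_le _ _) hst

theorem le_maxSpeed_mul (hξ : IsChar V w ξ) {s t : ℝ} (hst : s ≤ t) :
    ξ t - ξ s ≤ V.maxSpeed * (t - s) :=
  image_sub_le_mul_sub_of_deriv_le hξ.differentiable
    (fun s => by rw [hξ.deriv_eq]; exact V.le_maxSpeed _ _) hst

theorem strictMono (hξ : IsChar V w ξ) : StrictMono ξ := fun s t hst => by
  linarith [hξ.minSpeed_mul_le hst.le, mul_pos V.minSpeed_pos (sub_pos.2 hst)]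

theorem minSpeed_mul_abs_le (hξ : IsChar V w ξ) (s t : ℝ) :
    V.minSpeed * |t - s| ≤ |ξ t - ξ s| := by
  wlog hst : s ≤ t generalizing s t
  · rw [abs_sub_comm, abs_sub_comm (ξ t)]
    exact this t s (le_of_not_ge hst)
  · rw [abs_of_nonneg (sub_nonneg.2 hst)]
    exact (hξ.minSpeed_mul_le hst).trans (le_abs_self _)

theorem abs_le_maxSpeed_mul (hξ : IsChar V w ξ) (s t : ℝ) :
    |ξ t - ξ s| ≤ V.maxSpeed * |t - s| := by
  wlog hst : s ≤ t generalizing s t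
  · rw [abs_sub_comm, abs_sub_comm t]
    exact this t s (le_of_not_ge hst)
  · rw [abs_of_nonneg (sub_nonneg.2 (hξ.strictMono.monotone hst)),
      abs_of_nonneg (sub_nonneg.2 hst)]
    exact hξ.le_maxSpeed_mul hst

theorem surjective (hξ : IsChar V w ξ) : Function.Surjective ξ := by
  refine hξ.continuous.surjective ?_ ?_
  · refine tendsto_atTop_mono' _ ?_
      (tendsto_atTop_add_const_right _ (ξ 0) (tendsto_id.const_mul_atTop V.minSpeed_pos))
    filter_upwards [eventually_ge_atTop 0] with s hs
    simp only [id_eq]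
    linarith [hξ.minSpeed_mul_le hs]
  · refine tendsto_atBot_mono' _ ?_
      (tendsto_atBot_add_const_right _ (ξ 0) (tendsto_id.const_mul_atBot V.minSpeed_pos))
    filter_upwards [eventually_le_atBot 0] with s hs
    simp only [id_eq]
    linarith [hξ.minSpeed_mul_le hs]

theorem ae_ne_zero (hξ : IsChar V w ξ) : ∀ᵐ s, ξ s ≠ 0 := by
  refine ae_iff.2 (Set.Subsingleton.measure_zero (fun a ha b hb => ?_) _)
  simp only [ne_eq, not_not, mem_ofPred_eq] at ha hb
  exact hξ.strictMono.injective (ha.trans hb.symm)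

theorem integral_velocity (hξ : IsChar V w ξ) (s t : ℝ) :
    ∫ r in s..t, V (ξ r) (w r) = ξ t - ξ s :=
  intervalIntegral.integral_eq_sub_of_hasDerivAt (fun r _ => hξ r)
    (hξ.continuous_velocity.intervalIntegrable _ _)

theorem abs_sub_le_add_integral (h₁ : IsChar V w₁ ξ₁) (h₂ : IsChar V w₂ ξ₂) (t s : ℝ) :
    |ξ₁ s - ξ₂ s| ≤ |ξ₁ t - ξ₂ t| + V.lipConst * |(∫ r in t..s, |w₁ r - w₂ r|)|
      + V.lipConst * |(∫ r in t..s, |ξ₁ r - ξ₂ r|)| := by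
  have hcont₁ := h₁.continuous
  have hcont₂ := h₂.continuous
  have hξint : IntervalIntegrable (fun r => |ξ₁ r - ξ₂ r|) volume t s :=
    Continuous.intervalIntegrable (by fun_prop) _ _
  have hwint : IntervalIntegrable (fun r => |w₁ r - w₂ r|) volume t s :=
    Continuous.intervalIntegrable (by fun_prop) _ _
  have hdiff : ξ₁ s - ξ₂ s
      = (ξ₁ t - ξ₂ t) + ∫ r in t..s, (V (ξ₁ r) (w₁ r) - V (ξ₂ r) (w₂ r)) := by
    rw [intervalIntegral.integral_sub (h₁.continuous_velocity.intervalIntegrable _ _)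
      (h₂.continuous_velocity.intervalIntegrable _ _), h₁.integral_velocity, h₂.integral_velocity]
    ring
  have hlip : |∫ r in t..s, (V (ξ₁ r) (w₁ r) - V (ξ₂ r) (w₂ r))|
      ≤ |∫ r in t..s, V.lipConst * (|ξ₁ r - ξ₂ r| + |w₁ r - w₂ r|)| :=
    intervalIntegral.norm_integral_le_abs_of_norm_le
      (f := fun r => V (ξ₁ r) (w₁ r) - V (ξ₂ r) (w₂ r))
      (Eventually.of_forall fun r => V.abs_sub_le _ _ _ _) ((hξint.add hwint).const_mul _)
  calc |ξ₁ s - ξ₂ s|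
      ≤ |ξ₁ t - ξ₂ t| + |∫ r in t..s, V.lipConst * (|ξ₁ r - ξ₂ r| + |w₁ r - w₂ r|)| := by
        rw [hdiff]
        exact (abs_add_le _ _).trans (by gcongr)
    _ = |ξ₁ t - ξ₂ t| + V.lipConst *
          |(∫ r in t..s, |ξ₁ r - ξ₂ r|) + (∫ r in t..s, |w₁ r - w₂ r|)| := by
        rw [intervalIntegral.integral_const_mul, intervalIntegral.integral_add hξint hwint,
          abs_mul, abs_of_nonneg V.lipConst_nonneg]
    _ ≤ _ := by
        have := mul_le_mul_of_nonneg_left (abs_add_le (∫ r in t..s, |ξ₁ r - ξ₂ r|)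
          (∫ r in t..s, |w₁ r - w₂ r|)) V.lipConst_nonneg
        linarith

theorem abs_sub_le_mul_exp (h₁ : IsChar V w₁ ξ₁) (h₂ : IsChar V w₂ ξ₂) (t s : ℝ) :
    |ξ₁ s - ξ₂ s| ≤ (|ξ₁ t - ξ₂ t| + V.lipConst * |(∫ r in t..s, |w₁ r - w₂ r|)|)
      * Real.exp (V.lipConst * |s - t|) := by
  have hcont₁ := h₁.continuous
  have hcont₂ := h₂.continuous
  have hL := V.lipConst_nonneg
  refine le_mul_exp_abs_of_le_add_mul_abs_integral (f := fun s => |ξ₁ s - ξ₂ s|) (by fun_prop)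
    (fun _ => abs_nonneg _) hL fun r hr => (h₁.abs_sub_le_add_integral h₂ t r).trans ?_
  have hmono : |(∫ q in t..r, |w₁ q - w₂ q|)| ≤ |(∫ q in t..s, |w₁ q - w₂ q|)| :=
    intervalIntegral.abs_integral_mono_interval
      (uIoc_subset_uIoc_of_uIcc_subset_uIcc (uIcc_subset_uIcc_left hr))
      (Eventually.of_forall fun q => abs_nonneg _)
      (Continuous.intervalIntegrable (by fun_prop) _ _)
  gcongr

theorem abs_sub_le_mul_exp_of_same_mass (h₁ : IsChar V w ξ₁) (h₂ : IsChar V w ξ₂) (t s : ℝ) :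
    |ξ₁ s - ξ₂ s| ≤ |ξ₁ t - ξ₂ t| * Real.exp (V.lipConst * |s - t|) := by
  simpa using abs_sub_le_mul_exp h₁ h₂ t s

theorem eq_of_apply_eq (h₁ : IsChar V w ξ₁) (h₂ : IsChar V w ξ₂) {t : ℝ} (ht : ξ₁ t = ξ₂ t) :
    ξ₁ = ξ₂ := by
  ext s
  simpa [ht, abs_nonpos_iff, sub_eq_zero] using abs_sub_le_mul_exp_of_same_mass h₁ h₂ t s

theorem apply_ne_of_apply_ne (h₁ : IsChar V w ξ₁) (h₂ : IsChar V w ξ₂) {t : ℝ}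
    (ht : ξ₁ t ≠ ξ₂ t) (s : ℝ) : ξ₁ s ≠ ξ₂ s :=
  fun hs => ht (congrFun (h₁.eq_of_apply_eq h₂ hs) t)

end IsChar

namespace RegularVelocity

variable (V : RegularVelocity) (w : C(ℝ, ℝ))

theorem exists_isChar (t x : ℝ) : ∃ ξ, ξ t = x ∧ IsChar V w ξ := by
  refine exists_eq_forall_hasDerivAt (v := fun s x => V x (w s)) (K := V.lipConst.toNNReal)
    (Λ := V.maxSpeed.toNNReal) (fun s => LipschitzWith.of_dist_le_mul fun x y => ?_)
    (fun x => V.continuous_comp continuous_const w.continuous) (fun s x => ?_) t x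
  · simpa [Real.dist_eq, Real.coe_toNNReal _ V.lipConst_nonneg] using V.abs_sub_le x (w s) y (w s)
  · rw [Real.norm_of_nonneg (V.pos _ _).le, Real.coe_toNNReal _ V.maxSpeed_pos.le]
    exact V.le_maxSpeed _ _

/-- The characteristic through position `x` at time `t`. -/
noncomputable def flow (t x : ℝ) : ℝ → ℝ := (V.exists_isChar w t x).choose

@[simp]
theorem flow_self (t x : ℝ) : V.flow w t x t = x := (V.exists_isChar w t x).choose_spec.1

theorem isChar_flow (t x : ℝ) : IsChar V w (V.flow w t x) := (V.exists_isChar w t x).choose_spec.2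

theorem continuous_flow (s : ℝ) :
    Continuous fun q : C(ℝ, ℝ) × ℝ × ℝ => V.flow q.1 q.2.1 q.2.2 s := by
  refine continuous_iff_continuousAt.2 fun ⟨w₀, t₀, x₀⟩ => tendsto_iff_dist_tendsto_zero.2 ?_
  have : Continuous fun q : C(ℝ, ℝ) × ℝ × ℝ => ∫ r in t₀..s, |q.1 r - w₀ r| :=
    intervalIntegral.continuous_parametric_intervalIntegral_of_continuous' (by fun_prop) _ _
  have hbound : Continuous fun q : C(ℝ, ℝ) × ℝ × ℝ =>
      (V.maxSpeed * |t₀ - q.2.1| + |q.2.2 - x₀| + V.lipConst * |(∫ r in t₀..s, |q.1 r - w₀ r|)|)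
        * Real.exp (V.lipConst * |s - t₀|) := by fun_prop
  refine squeeze_zero (fun _ => dist_nonneg) (fun ⟨w, t, x⟩ => ?_)
    (by simpa using hbound.tendsto (w₀, t₀, x₀))
  have hξ := V.isChar_flow w t x
  have hstart : |V.flow w t x t₀ - x₀| ≤ V.maxSpeed * |t₀ - t| + |x - x₀| := by
    have hdrift := hξ.abs_le_maxSpeed_mul t t₀
    rw [flow_self] at hdrift
    exact (_root_.abs_sub_le _ x _).trans (by gcongr)
  refine (hξ.abs_sub_le_mul_exp (V.isChar_flow w₀ t₀ x₀) t₀ s).trans ?_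
  rw [flow_self]
  gcongr

/-- The distance travelled between times `0` and `s` by a particle moving with the velocity at the
inlet `x = 0`. -/
noncomputable def inletShift (s : ℝ) : ℝ := ∫ r in (0 : ℝ)..s, V 0 (w r)

@[simp] theorem inletShift_zero : V.inletShift w 0 = 0 := by simp [inletShift]

theorem isChar_inletShift : IsChar V.atInlet w (V.inletShift w) := fun s =>
  (V.continuous_comp continuous_const w.continuous).integral_hasStrictDerivAt 0 s |>.hasDerivAt

theorem continuous_inletShift_apply (s : ℝ) : Continuous fun w : C(ℝ, ℝ) => V.inletShift w s :=
  intervalIntegral.continuous_parametric_intervalIntegral_of_continuous'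
    (f := fun (w : C(ℝ, ℝ)) r => V 0 (w r)) (V.continuous_comp continuous_const continuous_eval) _ _

/-- The time, possibly negative, at which a particle that is at `σ` at time `0` and moves with the
velocity at the inlet passes `x = 0`. For `σ ≤ 0` this is when the particle enters the domain. -/
noncomputable def entryTime (σ : ℝ) : ℝ := Function.surjInv (V.isChar_inletShift w).surjective (-σ)

theorem inletShift_entryTime (σ : ℝ) : V.inletShift w (V.entryTime w σ) = -σ :=
  Function.surjInv_eq _ _

theorem entryTime_lt_iff {σ s : ℝ} : V.entryTime w σ < s ↔ 0 < σ + V.inletShift w s := by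
  rw [← (V.isChar_inletShift w).strictMono.lt_iff_lt, inletShift_entryTime, neg_lt_iff_pos_add']

theorem abs_sub_le_maxSpeed_mul_entryTime (σ σ' : ℝ) :
    |σ - σ'| ≤ V.maxSpeed * |V.entryTime w σ - V.entryTime w σ'| := by
  have := (V.isChar_inletShift w).abs_le_maxSpeed_mul (V.entryTime w σ') (V.entryTime w σ)
  rwa [inletShift_entryTime, inletShift_entryTime, neg_sub_neg, abs_sub_comm] at this

theorem continuous_entryTime : Continuous fun q : C(ℝ, ℝ) × ℝ => V.entryTime q.1 q.2 := by
  refine continuous_iff_continuousAt.2 fun ⟨w₀, σ₀⟩ => tendsto_iff_dist_tendsto_zero.2 ?_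
  set e := V.entryTime w₀ σ₀ with he
  have hbound : Continuous fun q : C(ℝ, ℝ) × ℝ => |-q.2 - V.inletShift q.1 e| / V.minSpeed := by
    have := (V.continuous_inletShift_apply e).comp (continuous_fst (Y := ℝ))
    fun_prop
  refine squeeze_zero (fun _ => dist_nonneg) (fun ⟨w, σ⟩ => ?_)
    (by simpa [he, inletShift_entryTime] using hbound.tendsto (w₀, σ₀))
  rw [Real.dist_eq, le_div_iff₀' V.minSpeed_pos, ← V.inletShift_entryTime w σ]
  exact (V.isChar_inletShift w).minSpeed_mul_abs_le e (V.entryTime w σ)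

theorem continuous_entryTime_apply : Continuous (V.entryTime w) :=
  V.continuous_entryTime.comp (Continuous.prodMk_right w)

theorem hasDerivAt_entryTime (σ : ℝ) :
    HasDerivAt (V.entryTime w) (-(V 0 (w (V.entryTime w σ)))⁻¹) σ := by
  rw [← inv_neg]
  exact (V.isChar_inletShift w (V.entryTime w σ)).neg.of_local_left_inverse
    (V.continuous_entryTime_apply w).continuousAt (neg_ne_zero.2 (V.pos _ _).ne')
    (Eventually.of_forall fun y => by simp [inletShift_entryTime])

end RegularVelocity

section EntryTime

variable {V : RegularVelocity} {w : C(ℝ, ℝ)} {ξ : ℝ → ℝ}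

theorem IsChar.eq_add_inletShift_of_nonpos (hξ : IsChar V w ξ) {s : ℝ} (hs : 0 ≤ s)
    (hξs : ξ s ≤ 0) : ξ s = ξ 0 + V.inletShift w s := by
  rw [← sub_eq_iff_eq_add', ← hξ.integral_velocity 0 s]
  refine intervalIntegral.integral_congr fun r hr => ?_
  rw [uIcc_of_le hs] at hr
  exact V.eq_of_nonpos _ ((hξ.strictMono.monotone hr.2).trans hξs) _

theorem IsChar.pos_iff_entryTime_lt (hξ : IsChar V w ξ) {s : ℝ} (hs : 0 ≤ s) :
    0 < ξ s ↔ V.entryTime w (ξ 0) < s := by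
  have hshift := (V.isChar_inletShift w).strictMono
  rw [V.entryTime_lt_iff]
  refine ⟨fun hpos => ?_, fun hpos => ?_⟩
  · rcases lt_or_ge 0 (ξ 0) with hξ0 | hξ0
    · have := hshift.monotone hs
      rw [V.inletShift_zero] at this
      linarith
    · obtain ⟨r, hr, hξr⟩ := intermediate_value_Icc hs hξ.continuous.continuousOn ⟨hξ0, hpos.le⟩
      have hrs : r < s := hξ.strictMono.lt_iff_lt.1 (hξr.trans_lt hpos)
      linarith [hξ.eq_add_inletShift_of_nonpos hr.1 hξr.le, hshift hrs]
  · by_contra! hle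
    linarith [hξ.eq_add_inletShift_of_nonpos hs hle]

end EntryTime

namespace RegularVelocity

variable (V : RegularVelocity) (w : C(ℝ, ℝ))

/-- The position at time `0` of the characteristic through position `x` at time `t`. -/
noncomputable def foot (t x : ℝ) : ℝ := V.flow w t x 0

theorem continuous_foot : Continuous fun q : C(ℝ, ℝ) × ℝ × ℝ => V.foot q.1 q.2.1 q.2.2 :=
  V.continuous_flow 0

theorem entryTime_foot_le {t x : ℝ} (ht : 0 ≤ t) (hx : 0 ≤ x) :
    V.entryTime w (V.foot w t x) ≤ t := by
  have hξ := V.isChar_flow w t x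
  by_contra! hlt
  have hpos := hξ.strictMono hlt
  rw [flow_self] at hpos
  exact lt_irrefl _ ((hξ.pos_iff_entryTime_lt (ht.trans hlt.le)).1 (hx.trans_lt hpos))

theorem abs_sub_le_exp_mul_foot (t x y : ℝ) :
    |x - y| ≤ Real.exp (V.lipConst * |t|) * |V.foot w t x - V.foot w t y| := by
  simpa [foot, mul_comm] using
    (V.isChar_flow w t x).abs_sub_le_mul_exp_of_same_mass (V.isChar_flow w t y) 0 t

theorem abs_sub_le_exp_div_mul_foot {T s t : ℝ} (x : ℝ) (hs : s ∈ Icc 0 T) (ht : t ∈ Icc 0 T) :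
    |s - t| ≤ Real.exp (V.lipConst * T) / V.minSpeed * |V.foot w s x - V.foot w t x| := by
  wlog hst : s ≤ t generalizing s t
  · rw [abs_sub_comm, abs_sub_comm (V.foot w s x)]
    exact this ht hs (le_of_not_ge hst)
  have hL := V.lipConst_nonneg
  have hξ := V.isChar_flow w t x
  rw [abs_sub_comm, abs_of_nonneg (sub_nonneg.2 hst), div_mul_eq_mul_div,
    le_div_iff₀' V.minSpeed_pos]
  calc V.minSpeed * (t - s) ≤ V.flow w t x t - V.flow w t x s := hξ.minSpeed_mul_le hst
    _ ≤ |V.flow w s x s - V.flow w t x s| := by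
        rw [flow_self, flow_self]
        exact le_abs_self _
    _ ≤ |V.foot w s x - V.foot w t x| * Real.exp (V.lipConst * |s - 0|) :=
        (V.isChar_flow w s x).abs_sub_le_mul_exp_of_same_mass hξ 0 s
    _ ≤ Real.exp (V.lipConst * T) * |V.foot w s x - V.foot w t x| := by
        rw [mul_comm, sub_zero, abs_of_nonneg hs.1]
        gcongr
        exact hs.2

/-- The rate at which the characteristics near the one through `(t, x)` separate at time `s`, that
is, the derivative of `V` in the position along that characteristic. It vanishes before the inlet is
reached, as `V` does not depend on the position there. -/
noncomputable def stretchRate (t x s : ℝ) : ℝ :=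
  if 0 < V.flow w t x s then V.deriv (V.flow w t x s) (w s) else 0

theorem abs_stretchRate_le (t x s : ℝ) : |V.stretchRate w t x s| ≤ V.lipConst := by
  unfold stretchRate
  split_ifs
  · exact V.abs_deriv_le _ _
  · simpa using V.lipConst_nonneg

theorem measurable_stretchRate (t x : ℝ) : Measurable (V.stretchRate w t x) := by
  have hξ := (V.isChar_flow w t x).continuous
  exact Measurable.ite (measurableSet_lt measurable_const hξ.measurable)
    (V.continuous_deriv_comp hξ w.continuous).measurable measurable_const

theorem continuousAt_stretchRate {t x s : ℝ} (hs : V.flow w t x s ≠ 0) :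
    ContinuousAt (fun q : C(ℝ, ℝ) × ℝ × ℝ => V.stretchRate q.1 q.2.1 q.2.2 s) (w, t, x) := by
  have hflow := V.continuous_flow s
  rcases hs.lt_or_gt with hneg | hpos
  · refine continuousAt_const.congr (f := fun _ => (0 : ℝ)) ?_
    filter_upwards [hflow.continuousAt.eventually (gt_mem_nhds hneg)] with q hq
    exact (if_neg (not_lt.2 hq.le)).symm
  · refine (V.continuous_deriv_comp hflow (by fun_prop : Continuous fun q : C(ℝ, ℝ) × ℝ × ℝ =>
      q.1 s)).continuousAt.congr ?_
    filter_upwards [hflow.continuousAt.eventually (lt_mem_nhds hpos)] with q hq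
    exact (if_pos hq).symm

/-- The derivative of `foot` in the position `x`, see `hasDerivAt_foot`. -/
noncomputable def footDeriv (t x : ℝ) : ℝ :=
  Real.exp (-∫ s in (0 : ℝ)..t, V.stretchRate w t x s)

theorem footDeriv_pos (t x : ℝ) : 0 < V.footDeriv w t x := Real.exp_pos _

theorem footDeriv_le (t x : ℝ) : V.footDeriv w t x ≤ Real.exp (V.lipConst * |t|) := by
  have := intervalIntegral.norm_integral_le_of_norm_le_const (a := 0) (b := t)
    (f := V.stretchRate w t x) (fun s _ => V.abs_stretchRate_le w t x s)
  rw [sub_zero] at this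
  exact Real.exp_le_exp.2 ((neg_le_abs _).trans this)

theorem continuous_footDeriv :
    Continuous fun q : C(ℝ, ℝ) × ℝ × ℝ => V.footDeriv q.1 q.2.1 q.2.2 := by
  refine continuous_iff_continuousAt.2 fun ⟨w₀, t₀, x₀⟩ => ?_
  obtain ⟨R, hR⟩ := exists_gt |t₀|
  have hprimitive := intervalIntegral.continuousAt_parametric_primitive_of_dominated (μ := volume)
    (F := fun (q : C(ℝ, ℝ) × ℝ × ℝ) s => V.stretchRate q.1 q.2.1 q.2.2 s)
    (x₀ := (w₀, t₀, x₀)) (a₀ := 0) (b₀ := t₀) (fun _ => V.lipConst) (-R) R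
    (fun q => (V.measurable_stretchRate _ _ _).aestronglyMeasurable)
    (Eventually.of_forall fun q => Eventually.of_forall fun s => V.abs_stretchRate_le _ _ _ _)
    intervalIntegrable_const
    (ae_restrict_of_ae ((V.isChar_flow w₀ t₀ x₀).ae_ne_zero.mono fun s hs =>
      V.continuousAt_stretchRate w₀ hs))
    (by constructor <;> linarith [abs_nonneg t₀]) (abs_lt.1 hR) (measure_singleton t₀)
  have hdiag : ContinuousAt (fun q : C(ℝ, ℝ) × ℝ × ℝ => (q, q.2.1)) (w₀, t₀, x₀) := by fun_prop
  exact (ContinuousAt.comp' (f := fun q : C(ℝ, ℝ) × ℝ × ℝ => (q, q.2.1)) hprimitive hdiag).neg.rexp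

/-- The slope of `V (·) (w s)` between the positions at time `s` of the characteristics that pass
through `y` and `x` at time `t`; it is `0` where they coincide. -/
noncomputable def secantRate (t x y s : ℝ) : ℝ :=
  slope (fun z => V z (w s)) (V.flow w t x s) (V.flow w t y s)

variable {w} {t x y : ℝ}

theorem flow_ne_flow (hxy : y ≠ x) (s : ℝ) : V.flow w t y s ≠ V.flow w t x s :=
  (V.isChar_flow w t y).apply_ne_of_apply_ne (V.isChar_flow w t x) (t := t) (by simpa using hxy) s

theorem abs_secantRate_le (s : ℝ) : |V.secantRate w t x y s| ≤ V.lipConst := by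
  rw [secantRate, slope_def_field, abs_div]
  refine div_le_of_le_mul₀ (abs_nonneg _) V.lipConst_nonneg ?_
  simpa using V.abs_sub_le (V.flow w t y s) (w s) (V.flow w t x s) (w s)

theorem continuous_secantRate (hxy : y ≠ x) : Continuous (V.secantRate w t x y) := by
  have hx := (V.isChar_flow w t x).continuous
  have hy := (V.isChar_flow w t y).continuous
  unfold secantRate
  simp only [slope_def_field]
  exact Continuous.div (by fun_prop) (hy.sub hx) fun s => sub_ne_zero.2 (V.flow_ne_flow hxy s)

theorem hasDerivAt_flow_sub_flow (s : ℝ) :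
    HasDerivAt (fun s => V.flow w t y s - V.flow w t x s)
      (V.secantRate w t x y s * (V.flow w t y s - V.flow w t x s)) s := by
  refine (V.isChar_flow w t y s).sub (V.isChar_flow w t x s) |>.congr_deriv ?_
  rw [secantRate, mul_comm, ← smul_eq_mul, sub_smul_slope, vsub_eq_sub]

theorem slope_foot (hxy : y ≠ x) :
    slope (V.foot w t) x y = Real.exp (-∫ s in (0 : ℝ)..t, V.secantRate w t x y s) := by
  have hconst : ∀ s, HasDerivAt (fun s => (V.flow w t y s - V.flow w t x s)
      * Real.exp (-∫ r in (0 : ℝ)..s, V.secantRate w t x y r)) 0 s := fun s => by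
    have hexp := ((V.continuous_secantRate hxy (t := t)).integral_hasStrictDerivAt 0 s
      |>.hasDerivAt (f := fun s => ∫ r in (0 : ℝ)..s, V.secantRate w t x y r)).neg.exp
    exact ((V.hasDerivAt_flow_sub_flow s).mul hexp).congr_deriv (by simp only [Pi.neg_apply]; ring)
  have heq := is_const_of_deriv_eq_zero (fun s => (hconst s).differentiableAt)
    (fun s => (hconst s).deriv) 0 t
  simp only [intervalIntegral.integral_same, neg_zero, Real.exp_zero, mul_one, flow_self] at heq
  rw [slope_def_field, foot, foot, heq, mul_div_cancel_left₀ _ (sub_ne_zero.2 hxy)]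

theorem tendsto_secantRate (hx : x ≤ 1) {s : ℝ} (hst : s < t) (hs : V.flow w t x s ≠ 0) :
    Tendsto (fun y => V.secantRate w t x y s) (𝓝[≠] x) (𝓝 (V.stretchRate w t x s)) := by
  have hflow : Tendsto (fun y => V.flow w t y s) (𝓝[≠] x) (𝓝 (V.flow w t x s)) :=
    (((V.continuous_flow s).comp (by fun_prop : Continuous fun y => (w, t, y))).tendsto x).mono_left
      nhdsWithin_le_nhds
  rcases hs.lt_or_gt with hneg | hpos
  · rw [stretchRate, if_neg hneg.not_gt]
    refine tendsto_const_nhds.congr' ?_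
    filter_upwards [hflow.eventually (gt_mem_nhds hneg)] with y hy
    rw [secantRate, slope_def_field, V.eq_of_nonpos _ hneg.le, V.eq_of_nonpos _ hy.le, sub_self,
      zero_div]
  · have hlt : V.flow w t x s < 1 :=
      ((V.isChar_flow w t x).strictMono hst).trans_le (by simpa using hx)
    rw [stretchRate, if_pos hpos]
    refine (V.hasDerivAt _ ⟨hpos, hlt⟩ (w s)).tendsto_slope.comp
      (tendsto_nhdsWithin_iff.2 ⟨hflow, ?_⟩)
    filter_upwards [self_mem_nhdsWithin] with y hy
    exact V.flow_ne_flow hy s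

theorem hasDerivAt_foot (ht : 0 ≤ t) (hx : x ≤ 1) :
    HasDerivAt (V.foot w t) (V.footDeriv w t x) x := by
  rw [hasDerivAt_iff_tendsto_slope]
  have hrate : Tendsto (fun y => ∫ s in (0 : ℝ)..t, V.secantRate w t x y s) (𝓝[≠] x)
      (𝓝 (∫ s in (0 : ℝ)..t, V.stretchRate w t x s)) := by
    refine intervalIntegral.tendsto_integral_filter_of_dominated_convergence (fun _ => V.lipConst)
      ?_ (Eventually.of_forall fun y => Eventually.of_forall fun s _ => V.abs_secantRate_le s)
      intervalIntegrable_const ?_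
    · filter_upwards [self_mem_nhdsWithin] with y hy
      exact (V.continuous_secantRate hy).aestronglyMeasurable
    · filter_upwards [(V.isChar_flow w t x).ae_ne_zero, Measure.ae_ne volume t] with s hs hst hmem
      rw [uIoc_of_le ht] at hmem
      exact V.tendsto_secantRate hx (hmem.2.lt_of_ne hst) hs
  refine ((Real.continuous_exp.comp continuous_neg).tendsto _).comp hrate |>.congr' ?_
  filter_upwards [self_mem_nhdsWithin] with y hy
  exact (V.slope_foot hy).symm

end RegularVelocity

theorem abs_projIcc_sub_projIcc_le {a b : ℝ} (h : a ≤ b) (x y : ℝ) :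
    |(projIcc a b h x : ℝ) - projIcc a b h y| ≤ |x - y| := by
  simpa [Real.dist_eq, Subtype.dist_eq] using (LipschitzWith.projIcc h).dist_le_mul x y

namespace IsVelocity

variable {lam : ℝ → ℝ → ℝ} {R C : ℝ}

theorem continuousOn_fderivWithin (hlam : IsVelocity lam) :
    ContinuousOn (fderivWithin ℝ (fun q : ℝ × ℝ => lam q.1 q.2) (Icc 0 1 ×ˢ Ici 0))
      (Icc 0 1 ×ˢ Ici 0) :=
  hlam.contDiffOn.continuousOn_fderivWithin
    ((uniqueDiffOn_Icc zero_lt_one).prod (uniqueDiffOn_Ici 0)) le_rfl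

theorem hasFDerivWithinAt (hlam : IsVelocity lam) {q : ℝ × ℝ} (hq : q ∈ Icc 0 1 ×ˢ Ici 0) :
    HasFDerivWithinAt (fun q : ℝ × ℝ => lam q.1 q.2)
      (fderivWithin ℝ (fun q : ℝ × ℝ => lam q.1 q.2) (Icc 0 1 ×ˢ Ici 0) q) (Icc 0 1 ×ˢ Ici 0) q :=
  (hlam.contDiffOn.differentiableOn one_ne_zero q hq).hasFDerivWithinAt

theorem hasDerivAt (hlam : IsVelocity lam) {x w : ℝ} (hx : x ∈ Ioo 0 1) (hw : 0 ≤ w) :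
    HasDerivAt (fun z => lam z w)
      (fderivWithin ℝ (fun q : ℝ × ℝ => lam q.1 q.2) (Icc 0 1 ×ˢ Ici 0) (x, w) (1, 0)) x := by
  have hline : HasDerivWithinAt (fun z : ℝ => (z, w)) ((1 : ℝ), (0 : ℝ)) (Icc 0 1) x :=
    (hasDerivWithinAt_id _ _).prodMk (hasDerivWithinAt_const _ _ _)
  have hmaps : MapsTo (fun z : ℝ => (z, w)) (Icc 0 1) (Icc 0 1 ×ˢ Ici 0) := fun z hz => ⟨hz, hw⟩
  exact ((hlam.hasFDerivWithinAt (hmaps (Ioo_subset_Icc_self hx))).comp_hasDerivWithinAt x hline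
    hmaps).hasDerivAt (Icc_mem_nhds hx.1 hx.2)

theorem exists_norm_fderivWithin_le (hlam : IsVelocity lam) (R : ℝ) :
    ∃ C, ∀ q ∈ Icc (0 : ℝ) 1 ×ˢ Icc 0 R,
      ‖fderivWithin ℝ (fun q : ℝ × ℝ => lam q.1 q.2) (Icc 0 1 ×ˢ Ici 0) q‖ ≤ C :=
  (isCompact_Icc.prod isCompact_Icc).exists_bound_of_continuousOn
    (hlam.continuousOn_fderivWithin.mono (prod_mono le_rfl Icc_subset_Ici_self))

theorem abs_sub_le_of_norm_fderivWithin_le (hlam : IsVelocity lam)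
    (hC : ∀ q ∈ Icc (0 : ℝ) 1 ×ˢ Icc 0 R,
      ‖fderivWithin ℝ (fun q : ℝ × ℝ => lam q.1 q.2) (Icc 0 1 ×ˢ Ici 0) q‖ ≤ C)
    {x w x' w' : ℝ} (hx : x ∈ Icc 0 1) (hw : w ∈ Icc 0 R) (hx' : x' ∈ Icc 0 1)
    (hw' : w' ∈ Icc 0 R) : |lam x w - lam x' w'| ≤ C * (|x - x'| + |w - w'|) := by
  have hsub : Icc (0 : ℝ) 1 ×ˢ Icc (0 : ℝ) R ⊆ Icc 0 1 ×ˢ Ici 0 :=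
    prod_mono le_rfl Icc_subset_Ici_self
  have hmem : ((x, w) : ℝ × ℝ) ∈ Icc (0 : ℝ) 1 ×ˢ Icc 0 R := ⟨hx, hw⟩
  have hC₀ : 0 ≤ C := (norm_nonneg _).trans (hC _ hmem)
  calc |lam x w - lam x' w'| ≤ C * ‖((x, w) : ℝ × ℝ) - (x', w')‖ :=
        Convex.norm_image_sub_le_of_norm_hasFDerivWithin_le (f := fun q : ℝ × ℝ => lam q.1 q.2)
          (fun q hq => (hlam.hasFDerivWithinAt (hsub hq)).mono hsub) hC
          ((convex_Icc 0 1).prod (convex_Icc 0 R)) (y := (x, w)) (x := (x', w')) ⟨hx', hw'⟩ hmem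
    _ ≤ C * (|x - x'| + |w - w'|) := by
        gcongr
        exact max_le (le_add_of_nonneg_right (abs_nonneg _)) (le_add_of_nonneg_left (abs_nonneg _))

theorem exists_pos_le_and_le (hlam : IsVelocity lam) (hR : 0 ≤ R) :
    ∃ m M : ℝ, 0 < m ∧ ∀ x ∈ Icc (0 : ℝ) 1, ∀ w ∈ Icc 0 R, m ≤ lam x w ∧ lam x w ≤ M := by
  have hcompact : IsCompact (Icc (0 : ℝ) 1 ×ˢ Icc 0 R) := isCompact_Icc.prod isCompact_Icc
  have hne : (Icc (0 : ℝ) 1 ×ˢ Icc 0 R).Nonempty :=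
    ⟨(0, 0), ⟨le_rfl, zero_le_one⟩, ⟨le_rfl, hR⟩⟩
  have hcont : ContinuousOn (fun q : ℝ × ℝ => lam q.1 q.2) (Icc 0 1 ×ˢ Icc 0 R) :=
    hlam.contDiffOn.continuousOn.mono (prod_mono le_rfl Icc_subset_Ici_self)
  obtain ⟨qmin, hqmin, hmin⟩ := hcompact.exists_isMinOn hne hcont
  obtain ⟨qmax, -, hmax⟩ := hcompact.exists_isMaxOn hne hcont
  exact ⟨_, _, hlam.pos _ hqmin.1 _ hqmin.2.1, fun x hx w hw =>
    ⟨hmin (a := (x, w)) ⟨hx, hw⟩, hmax (a := (x, w)) ⟨hx, hw⟩⟩⟩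

theorem exists_regularVelocity (hlam : IsVelocity lam) (hR : 0 ≤ R) :
    ∃ V : RegularVelocity, ∀ x ∈ Icc (0 : ℝ) 1, ∀ w ∈ Icc 0 R, V x w = lam x w := by
  obtain ⟨m, M, hm, hbounds⟩ := hlam.exists_pos_le_and_le hR
  obtain ⟨C, hC⟩ := hlam.exists_norm_fderivWithin_le R
  set px : ℝ → ℝ := fun x => projIcc 0 1 zero_le_one x
  set pw : ℝ → ℝ := fun w => projIcc 0 R hR w
  have hpx : ∀ x, px x ∈ Icc 0 1 := fun x => (projIcc 0 1 zero_le_one x).2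
  have hpw : ∀ w, pw w ∈ Icc 0 R := fun w => (projIcc 0 R hR w).2
  have hpx_self : ∀ x ∈ Icc 0 1, px x = x := fun x hx => by simp only [px, projIcc_of_mem _ hx]
  have hpw_self : ∀ w ∈ Icc 0 R, pw w = w := fun w hw => by simp only [pw, projIcc_of_mem _ hw]
  have hpxc : Continuous px := continuous_subtype_val.comp continuous_projIcc
  have hpwc : Continuous pw := continuous_subtype_val.comp continuous_projIcc
  have hC₀ : 0 ≤ C := (norm_nonneg _).trans (hC (px 0, pw 0) ⟨hpx 0, hpw 0⟩)
  refine ⟨{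
    toFun x w := lam (px x) (pw w)
    deriv x w :=
      fderivWithin ℝ (fun q : ℝ × ℝ => lam q.1 q.2) (Icc 0 1 ×ˢ Ici 0) (px x, pw w) (1, 0)
    minSpeed := m
    maxSpeed := M
    lipConst := C
    minSpeed_pos := hm
    minSpeed_le x w := (hbounds _ (hpx x) _ (hpw w)).1
    le_maxSpeed x w := (hbounds _ (hpx x) _ (hpw w)).2
    abs_sub_le x w x' w' :=
      (hlam.abs_sub_le_of_norm_fderivWithin_le hC (hpx x) (hpw w) (hpx x') (hpw w')).trans
        (mul_le_mul_of_nonneg_left (add_le_add (abs_projIcc_sub_projIcc_le _ _ _)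
          (abs_projIcc_sub_projIcc_le _ _ _)) hC₀)
    eq_of_nonpos x hx w := by simp only [px, projIcc_of_le_left _ hx, projIcc_of_le_left _ le_rfl]
    hasDerivAt x hx w := by
      rw [hpx_self x (Ioo_subset_Icc_self hx)]
      refine (hlam.hasDerivAt hx (hpw w).1).congr_of_eventuallyEq ?_
      filter_upwards [isOpen_Ioo.mem_nhds hx] with z hz
      rw [hpx_self z (Ioo_subset_Icc_self hz)]
    continuous_deriv := by
      refine (hlam.continuousOn_fderivWithin.comp_continuous
        ((hpxc.comp continuous_fst).prodMk (hpwc.comp continuous_snd))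
        fun q => ⟨hpx q.1, (hpw q.2).1⟩).clm_apply continuous_const
    abs_deriv_le x w := by
      simpa [Prod.norm_def] using
        ContinuousLinearMap.le_of_opNorm_le _ (hC (px x, pw w) ⟨hpx x, hpw w⟩) (1, 0) }, ?_⟩
  intro x hx w hw
  exact congrArg₂ lam (hpx_self x hx) (hpw_self w hw)

end IsVelocity

instance (a : ℝ) : IsFiniteMeasure (volIoo a) := by
  unfold volIoo; infer_instance

theorem integral_volIoo {a : ℝ} (ha : 0 ≤ a) (f : ℝ → ℝ) :
    ∫ x in (0 : ℝ)..a, f x = ∫ x, f x ∂volIoo a := by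
  rw [intervalIntegral.integral_of_le ha, integral_Ioc_eq_integral_Ioo, volIoo]

theorem intervalIntegrable_of_integrable_volIoo {a b : ℝ} {f : ℝ → ℝ}
    (hf : Integrable f (volIoo a)) (hb : b ∈ Icc 0 a) : IntervalIntegrable f volume 0 b := by
  rw [intervalIntegrable_iff_integrableOn_Ioo_of_le hb.1]
  exact (show IntegrableOn f (Ioo 0 a) volume from hf).mono_set (Ioo_subset_Ioo_right hb.2)

theorem continuousOn_integral_of_integrable_volIoo {a : ℝ} {f : ℝ → ℝ} (ha : 0 ≤ a)
    (hf : Integrable f (volIoo a)) : ContinuousOn (fun τ => ∫ s in (0 : ℝ)..τ, f s) (Icc 0 a) := by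
  have hac := (intervalIntegrable_of_integrable_volIoo hf (right_mem_Icc.2 ha)
    ).absolutelyContinuousOnInterval_intervalIntegral (c := 0) left_mem_uIcc
  simpa [uIcc_of_le ha] using hac.continuousOn

theorem integral_sub_mul_eq_integral_integral {f : ℝ → ℝ} {a : ℝ}
    (hf : IntervalIntegrable f volume 0 a) :
    ∫ t in (0 : ℝ)..a, (a - t) * f t = ∫ s in (0 : ℝ)..a, ∫ t in (0 : ℝ)..s, f t := by
  have hlin : AbsolutelyContinuousOnInterval (fun t => a - t) 0 a :=
    (IsometryEquiv.subLeft a).isometry.lipschitz.lipschitzOnWith.absolutelyContinuousOnInterval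
  have hparts := hlin.integral_mul_deriv_eq_deriv_mul
    (hf.absolutelyContinuousOnInterval_intervalIntegral (c := 0) left_mem_uIcc)
  have hderiv : ∫ t in (0 : ℝ)..a, (a - t) * deriv (fun s => ∫ t in (0 : ℝ)..s, f t) t
      = ∫ t in (0 : ℝ)..a, (a - t) * f t := by
    refine intervalIntegral.integral_congr_ae ?_
    filter_upwards [hf.ae_hasDerivAt_integral] with x hx hmem
    rw [(hx (uIoc_subset_uIcc hmem) 0 left_mem_uIcc).deriv]
  simpa [hderiv] using hparts

theorem eq_of_integral_eq {f g : ℝ → ℝ} {a : ℝ} (ha : 0 < a) (hf : ContinuousOn f (Icc 0 a))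
    (hg : ContinuousOn g (Icc 0 a))
    (h : ∀ τ ∈ Icc 0 a, ∫ t in (0 : ℝ)..τ, f t = ∫ t in (0 : ℝ)..τ, g t) : f a = g a := by
  have hmem : a ∈ Icc 0 a := right_mem_Icc.2 ha.le
  have hderiv : ∀ {f : ℝ → ℝ}, ContinuousOn f (Icc 0 a) →
      HasDerivWithinAt (fun τ => ∫ t in (0 : ℝ)..τ, f t) (f a) (Icc 0 a) a := fun {f} hf => by
    have : Fact (a ∈ Icc 0 a) := ⟨hmem⟩
    exact intervalIntegral.integral_hasDerivWithinAt_right (hf.intervalIntegrable_of_Icc ha.le)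
      (hf.stronglyMeasurableAtFilter_nhdsWithin measurableSet_Icc a) (hf a hmem)
  exact (uniqueDiffOn_Icc ha a hmem).eq_deriv _ (hderiv hf) ((hderiv hg).congr h (h a hmem))

theorem deriv_smoothTransition_eq_zero {y : ℝ} (hy : y ∉ Icc (0 : ℝ) 1) :
    deriv Real.smoothTransition y = 0 := by
  rw [mem_Icc, not_and_or, not_le, not_le] at hy
  rcases hy with hy | hy
  · have hzero : Real.smoothTransition =ᶠ[𝓝 y] fun _ => 0 := by
      filter_upwards [gt_mem_nhds hy] with z hz
      exact Real.smoothTransition.zero_of_nonpos hz.le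
    rw [hzero.deriv_eq, deriv_const]
  · have hone : Real.smoothTransition =ᶠ[𝓝 y] fun _ => 1 := by
      filter_upwards [lt_mem_nhds hy] with z hz
      exact Real.smoothTransition.one_of_one_le hz.le
    rw [hone.deriv_eq, deriv_const]

theorem continuous_deriv_smoothTransition : Continuous (deriv Real.smoothTransition) :=
  (Real.smoothTransition.contDiff (n := 1)).continuous_deriv le_rfl

theorem exists_abs_deriv_smoothTransition_le :
    ∃ C : ℝ≥0, ∀ y, |deriv Real.smoothTransition y| ≤ C := by
  obtain ⟨C, hC⟩ := (isCompact_Icc (a := (0 : ℝ)) (b := 1)).exists_bound_of_continuousOn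
    continuous_deriv_smoothTransition.continuousOn
  refine ⟨C.toNNReal, fun y => ?_⟩
  by_cases hy : y ∈ Icc (0 : ℝ) 1
  · exact (hC y hy).trans (Real.le_coe_toNNReal C)
  · rw [deriv_smoothTransition_eq_zero hy, abs_zero]
    exact NNReal.coe_nonneg _

theorem abs_smoothTransition_le_one (y : ℝ) : |Real.smoothTransition y| ≤ 1 :=
  abs_le.2 ⟨by linarith [Real.smoothTransition.nonneg y], Real.smoothTransition.le_one y⟩

theorem tendsto_mul_natCast_add_one_atTop {d : ℝ} (hd : 0 < d) :
    Tendsto (fun n : ℕ => d * ((n : ℝ) + 1)) atTop atTop :=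
  (tendsto_atTop_add_const_right _ _ tendsto_natCast_atTop_atTop).const_mul_atTop hd

theorem abs_deriv_smoothTransition_mul_le {C L d δ k : ℝ}
    (hC : ∀ y, |deriv Real.smoothTransition y| ≤ C) (hL : 0 ≤ L) (hk : 0 < k)
    (hδ : |δ| ≤ L * |d|) : |deriv Real.smoothTransition (d * k) * k * δ| ≤ C * L := by
  have hC₀ : 0 ≤ C := (abs_nonneg _).trans (hC 0)
  by_cases hmem : d * k ∈ Icc (0 : ℝ) 1
  · have hdk : |d| * k ≤ 1 := by
      rw [← abs_of_pos hk, ← abs_mul, abs_of_nonneg hmem.1]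
      exact hmem.2
    calc |deriv Real.smoothTransition (d * k) * k * δ|
        = |deriv Real.smoothTransition (d * k)| * k * |δ| := by
          rw [abs_mul, abs_mul, abs_of_pos hk]
      _ ≤ C * k * (L * |d|) := by gcongr; exact hC _
      _ = C * L * (|d| * k) := by ring
      _ ≤ C * L := mul_le_of_le_one_right (mul_nonneg hC₀ hL) hdk
  · rw [deriv_smoothTransition_eq_zero hmem, zero_mul, zero_mul, abs_zero]
    exact mul_nonneg hC₀ hL

theorem tendsto_deriv_smoothTransition_mul {d δ : ℝ} (hδ : d = 0 → δ = 0) :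
    Tendsto (fun n : ℕ => deriv Real.smoothTransition (d * (n + 1)) * (n + 1) * δ) atTop
      (𝓝 0) := by
  refine tendsto_const_nhds.congr' ?_
  rcases lt_trichotomy d 0 with hd | hd | hd
  · refine Eventually.of_forall fun n => ?_
    have hneg : d * (n + 1) < 0 := mul_neg_of_neg_of_pos hd (by positivity)
    simp only [deriv_smoothTransition_eq_zero fun hmem => hneg.not_ge hmem.1, zero_mul]
  · simp only [hδ hd, mul_zero, EventuallyEq.rfl]
  · filter_upwards [(tendsto_mul_natCast_add_one_atTop hd).eventually_gt_atTop 1] with n hn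
    rw [deriv_smoothTransition_eq_zero fun hmem => hn.not_ge hmem.2, zero_mul, zero_mul]

/-- The Heaviside function, with value `0` at the origin so that `heaviside (a - x)` is the
indicator function of `x < a`. -/
noncomputable def heaviside (d : ℝ) : ℝ := if 0 < d then 1 else 0

theorem heaviside_of_pos {d : ℝ} (hd : 0 < d) : heaviside d = 1 := if_pos hd

theorem heaviside_of_nonpos {d : ℝ} (hd : d ≤ 0) : heaviside d = 0 := if_neg hd.not_gt

theorem abs_heaviside_le_one (d : ℝ) : |heaviside d| ≤ 1 := by
  unfold heaviside; split_ifs <;> simp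

theorem measurable_heaviside : Measurable heaviside :=
  Measurable.ite measurableSet_Ioi measurable_const measurable_const

theorem continuousAt_heaviside {d : ℝ} (hd : d ≠ 0) : ContinuousAt heaviside d := by
  refine (continuousAt_const (y := heaviside d)).congr ?_
  rcases hd.lt_or_gt with hd | hd
  · filter_upwards [gt_mem_nhds hd] with z hz
    rw [heaviside_of_nonpos hd.le, heaviside_of_nonpos hz.le]
  · filter_upwards [lt_mem_nhds hd] with z hz
    rw [heaviside_of_pos hd, heaviside_of_pos hz]

theorem tendsto_smoothTransition_mul (d : ℝ) :
    Tendsto (fun n : ℕ => Real.smoothTransition (d * (n + 1))) atTop (𝓝 (heaviside d)) := by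
  refine tendsto_const_nhds.congr' ?_
  rcases lt_or_ge 0 d with hd | hd
  · filter_upwards [(tendsto_mul_natCast_add_one_atTop hd).eventually_ge_atTop 1] with n hn
    rw [heaviside_of_pos hd, Real.smoothTransition.one_of_one_le hn]
  · refine Eventually.of_forall fun n => ?_
    have hle : d * (n + 1) ≤ 0 := mul_nonpos_of_nonpos_of_nonneg hd (by positivity)
    simp only [heaviside_of_nonpos hd, Real.smoothTransition.zero_of_nonpos hle]

theorem tendsto_integral_mul_smoothTransition {α : Type*} [MeasurableSpace α] {μ : Measure α}
    {f d : α → ℝ} (hf : Integrable f μ) (hd : Measurable d) :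
    Tendsto (fun n : ℕ => ∫ x, f x * Real.smoothTransition (d x * (n + 1)) ∂μ) atTop
      (𝓝 (∫ x, f x * heaviside (d x) ∂μ)) := by
  refine tendsto_integral_of_dominated_convergence (fun x => |f x|) (fun n => ?_) hf.abs
    (fun n => Eventually.of_forall fun x => ?_)
    (Eventually.of_forall fun x => (tendsto_smoothTransition_mul _).const_mul _)
  · exact hf.aestronglyMeasurable.mul (Real.smoothTransition.continuous.measurable.comp
      (hd.mul_const _)).aestronglyMeasurable
  · rw [norm_mul]
    exact mul_le_of_le_one_right (abs_nonneg _) (abs_smoothTransition_le_one _)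

/-- The test function `(τ - t) S(k (ξ(t) - x))`, with `S` the smooth transition from `0` to `1`.
As `k → ∞` it singles out the region on the left of the curve `ξ`. -/
noncomputable def leftCutoff (ξ : ℝ → ℝ) (τ k t x : ℝ) : ℝ :=
  (τ - t) * Real.smoothTransition ((ξ t - x) * k)

/-- The derivative `∂ₜ φ + V ∂ₓ φ` of `φ = leftCutoff ξ τ k`, for a characteristic `ξ`. -/
noncomputable def RegularVelocity.transportLeftCutoff (V : RegularVelocity) (w : C(ℝ, ℝ))
    (ξ : ℝ → ℝ) (τ k t x : ℝ) : ℝ :=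
  -Real.smoothTransition ((ξ t - x) * k)
    + (τ - t) * (_root_.deriv Real.smoothTransition ((ξ t - x) * k) * k
      * (V (ξ t) (w t) - V x (w t)))

namespace IsChar

variable {V : RegularVelocity} {w : C(ℝ, ℝ)} {ξ : ℝ → ℝ}

theorem isTestFunction_leftCutoff (hξ : IsChar V w ξ) {τ k : ℝ} (hξτ : ξ τ ≤ 1) (hk : 0 ≤ k) :
    IsTestFunction τ (leftCutoff ξ τ k) where
  contDiffOn := by
    have hS : ContDiff ℝ 1 Real.smoothTransition := Real.smoothTransition.contDiff
    exact ((contDiff_const.sub contDiff_fst).mul (hS.comp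
      (((hξ.contDiff.comp contDiff_fst).sub contDiff_snd).mul contDiff_const))).contDiffOn
  final x _ := by simp [leftCutoff]
  right t ht := by
    have hle : ξ t - 1 ≤ 0 := sub_nonpos.2 ((hξ.strictMono.monotone ht.2).trans hξτ)
    rw [leftCutoff, Real.smoothTransition.zero_of_nonpos
      (mul_nonpos_of_nonpos_of_nonneg hle hk), mul_zero]

theorem derivWithin_leftCutoff (hξ : IsChar V w ξ) (k : ℝ) {τ t x : ℝ} (hτ : 0 < τ)
    (ht : t ∈ Icc 0 τ) (hx : x ∈ Icc 0 1) :
    derivWithin (fun s => leftCutoff ξ τ k s x) (Icc 0 τ) t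
        + V x (w t) * derivWithin (fun z => leftCutoff ξ τ k t z) (Icc 0 1) x
      = V.transportLeftCutoff w ξ τ k t x := by
  have hS : HasDerivAt Real.smoothTransition (deriv Real.smoothTransition ((ξ t - x) * k))
      ((ξ t - x) * k) :=
    ((Real.smoothTransition.contDiff (n := 1)).differentiable one_ne_zero _).hasDerivAt
  have htime : HasDerivAt (fun s => leftCutoff ξ τ k s x) _ t :=
    ((hasDerivAt_id t).const_sub τ).mul
      (HasDerivAt.comp (h₂ := Real.smoothTransition) t hS (((hξ t).sub_const x).mul_const k))
  have hspace : HasDerivAt (fun z => leftCutoff ξ τ k t z) _ x :=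
    (HasDerivAt.comp (h₂ := Real.smoothTransition) x hS
      (((hasDerivAt_id x).const_sub (ξ t)).mul_const k)).const_mul (τ - t)
  rw [htime.hasDerivWithinAt.derivWithin (uniqueDiffOn_Icc hτ t ht),
    hspace.hasDerivWithinAt.derivWithin (uniqueDiffOn_Icc zero_lt_one x hx),
    RegularVelocity.transportLeftCutoff]
  simp only [id_eq]
  ring

end IsChar

namespace RegularVelocity

variable (V : RegularVelocity) (w : C(ℝ, ℝ)) {ξ : ℝ → ℝ} {T τ : ℝ}

theorem continuous_transportLeftCutoff (hξ : Continuous ξ) (τ k : ℝ) :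
    Continuous fun q : ℝ × ℝ => V.transportLeftCutoff w ξ τ k q.1 q.2 := by
  have := Real.smoothTransition.continuous
  have := continuous_deriv_smoothTransition
  unfold transportLeftCutoff
  fun_prop

theorem exists_abs_transportLeftCutoff_le (ξ : ℝ → ℝ) (hτ : τ ∈ Icc 0 T) :
    ∃ M : ℝ≥0, ∀ k > 0, ∀ t ∈ Icc 0 T, ∀ x, |V.transportLeftCutoff w ξ τ k t x| ≤ M := by
  obtain ⟨C, hC⟩ := exists_abs_deriv_smoothTransition_le
  have hbound : 0 ≤ 1 + T * (C * V.lipConst) := by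
    have := V.lipConst_nonneg
    have := hτ.1.trans hτ.2
    positivity
  refine ⟨⟨_, hbound⟩, fun k hk t ht x => ?_⟩
  have hspeed : |V (ξ t) (w t) - V x (w t)| ≤ V.lipConst * |ξ t - x| := by
    simpa using V.abs_sub_le (ξ t) (w t) x (w t)
  have hτt : |τ - t| ≤ T := abs_le.2 ⟨by linarith [ht.2, hτ.1], by linarith [ht.1, hτ.2]⟩
  unfold transportLeftCutoff
  refine (abs_add_le _ _).trans (add_le_add ?_ ?_)
  · rw [abs_neg]
    exact abs_smoothTransition_le_one _
  · rw [abs_mul]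
    exact mul_le_mul hτt (abs_deriv_smoothTransition_mul_le hC V.lipConst_nonneg hk hspeed)
      (abs_nonneg _) (hτ.1.trans hτ.2)

theorem tendsto_transportLeftCutoff (ξ : ℝ → ℝ) (τ t x : ℝ) :
    Tendsto (fun n : ℕ => V.transportLeftCutoff w ξ τ (n + 1) t x) atTop
      (𝓝 (-heaviside (ξ t - x))) := by
  have hspeed : ξ t - x = 0 → V (ξ t) (w t) - V x (w t) = 0 := fun h => by
    rw [sub_eq_zero.1 h, sub_self]
  simpa [transportLeftCutoff] using (tendsto_smoothTransition_mul (ξ t - x)).neg.add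
    ((tendsto_deriv_smoothTransition_mul hspeed).const_mul (τ - t))

end RegularVelocity

/-- The regular velocity `V` and the path `w` describe the transport of `ρ` up to time `T`: `w` is
the total mass of `ρ`, and `V` agrees with `lam` on `[0,1]` at the masses `ρ` goes through. -/
structure RegularVelocity.Transports (V : RegularVelocity) (w : C(ℝ, ℝ)) (lam : ℝ → ℝ → ℝ) (T : ℝ)
    (ρ : ℝ → ℝ → ℝ) : Prop where
  mass_eq : ∀ t ∈ Icc 0 T, w t = totalMass ρ t
  velocity_eq : ∀ t ∈ Icc 0 T, ∀ x ∈ Icc (0 : ℝ) 1, V x (w t) = lam x (totalMass ρ t)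

namespace IsWeakSolution

variable {lam : ℝ → ℝ → ℝ} {T : ℝ} {ρ₀ u : ℝ → ℝ} {ρ : ℝ → ℝ → ℝ}

theorem integrable (hs : IsWeakSolution lam T ρ₀ u ρ) {t : ℝ} (ht : t ∈ Icc 0 T) :
    Integrable (ρ t) (volIoo 1) :=
  memLp_one_iff_integrable.1 (hs.memLp_one t ht)

theorem continuousOn_integral_mul (hs : IsWeakSolution lam T ρ₀ u ρ) {ψ : ℝ → ℝ → ℝ} {M : ℝ≥0}
    (hψm : ∀ t, AEStronglyMeasurable (ψ t) (volIoo 1))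
    (hψ : ∀ t ∈ Icc 0 T, ∀ x, |ψ t x| ≤ M)
    (hψc : ∀ s ∈ Icc 0 T, ∀ᵐ x ∂volIoo 1, ContinuousAt (fun t => ψ t x) s) :
    ContinuousOn (fun t => ∫ x, ρ t x * ψ t x ∂volIoo 1) (Icc 0 T) := by
  have hprod : ∀ t ∈ Icc 0 T, Integrable (ψ t * ρ t) (volIoo 1) := fun t ht =>
    (hs.integrable ht).bdd_mul (hψm t) (Eventually.of_forall (hψ t ht))
  intro s hsT
  rw [ContinuousWithinAt, tendsto_nhdsWithin_iff_subtype hsT]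
  simp only [mul_comm (ρ _ _)]
  refine tendsto_integral_of_L1' _ (hprod s hsT).1 (Eventually.of_forall fun t => hprod t t.2) ?_
  refine tendsto_eLpNorm_one_mul_sub (M := M) (a := fun t : Icc 0 T => ψ t)
    (f := fun t : Icc 0 T => ρ t) (fun t => hψm t) (hψm s)
    (fun t => Eventually.of_forall (hψ t t.2)) (Eventually.of_forall (hψ s hsT)) ?_
    (fun t => (hs.integrable t.2).1) (hs.integrable hsT) ?_
  · filter_upwards [hψc s hsT] with x hx
    exact hx.tendsto.comp (continuous_subtype_val.tendsto (⟨s, hsT⟩ : Icc 0 T))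
  · exact (tendsto_nhdsWithin_iff_subtype hsT _ _).1 (hs.continuous_L1 s hsT)

theorem continuousOn_integral_abs (hs : IsWeakSolution lam T ρ₀ u ρ) :
    ContinuousOn (fun t => ∫ x, |ρ t x| ∂volIoo 1) (Icc 0 T) := by
  intro s hsT
  refine tendsto_integral_of_L1' _ (hs.integrable hsT).abs.1
    (eventually_mem_nhdsWithin.mono fun t ht => (hs.integrable ht).abs) ?_
  exact tendsto_of_tendsto_of_tendsto_of_le_of_le tendsto_const_nhds (hs.continuous_L1 s hsT)
    (fun _ => bot_le) fun t => eLpNorm_mono fun x => abs_abs_sub_abs_le _ _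

theorem continuousOn_totalMass (hs : IsWeakSolution lam T ρ₀ u ρ) :
    ContinuousOn (totalMass ρ) (Icc 0 T) := by
  refine (hs.continuousOn_integral_mul (ψ := fun _ _ => 1) (M := 1)
    (fun _ => aestronglyMeasurable_const) (by simp)
    (fun _ _ => Eventually.of_forall fun _ => continuousAt_const)).congr fun t _ => ?_
  simp [totalMass, integral_volIoo zero_le_one]

theorem tendsto_integral_integral_mul (hs : IsWeakSolution lam T ρ₀ u ρ) {ψ : ℕ → ℝ → ℝ → ℝ}
    {ψ₀ : ℝ → ℝ → ℝ} {M : ℝ≥0} (hψc : ∀ n, Continuous fun q : ℝ × ℝ => ψ n q.1 q.2)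
    (hψ : ∀ n, ∀ t ∈ Icc 0 T, ∀ x, |ψ n t x| ≤ M)
    (hψlim : ∀ t x, Tendsto (fun n => ψ n t x) atTop (𝓝 (ψ₀ t x))) {τ : ℝ} (hτ : τ ∈ Icc 0 T) :
    Tendsto (fun n => ∫ t in (0 : ℝ)..τ, ∫ x, ρ t x * ψ n t x ∂volIoo 1) atTop
      (𝓝 (∫ t in (0 : ℝ)..τ, ∫ x, ρ t x * ψ₀ t x ∂volIoo 1)) := by
  have hsub : Ioc 0 τ ⊆ Icc 0 T := fun t ht => ⟨ht.1.le, ht.2.trans hτ.2⟩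
  have hψm : ∀ n t, AEStronglyMeasurable (ψ n t) (volIoo 1) := fun n t =>
    ((hψc n).comp (Continuous.prodMk_right t)).aestronglyMeasurable
  have hle : ∀ n, ∀ t ∈ Ioc 0 τ, ∀ x, ‖ρ t x * ψ n t x‖ ≤ |ρ t x| * M := fun n t ht x => by
    rw [norm_mul]
    exact mul_le_mul_of_nonneg_left (hψ n t (hsub ht) x) (abs_nonneg _)
  refine intervalIntegral.tendsto_integral_filter_of_dominated_convergence
    (fun t => (∫ x, |ρ t x| ∂volIoo 1) * M) (Eventually.of_forall fun n => ?_)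
    (Eventually.of_forall fun n => Eventually.of_forall fun t ht => ?_) ?_
    (Eventually.of_forall fun t ht => ?_)
  · rw [uIoc_of_le hτ.1]
    exact ((hs.continuousOn_integral_mul (hψm n) (hψ n) fun s _ => Eventually.of_forall fun x =>
      ((hψc n).comp (Continuous.prodMk_left x)).continuousAt).mono hsub).aestronglyMeasurable
        measurableSet_Ioc
  · rw [uIoc_of_le hτ.1] at ht
    rw [← integral_mul_const]
    exact norm_integral_le_of_norm_le ((hs.integrable (hsub ht)).abs.mul_const _)
      (Eventually.of_forall (hle n t ht))
  · exact ((hs.continuousOn_integral_abs.mono (Icc_subset_Icc_right hτ.2)).mul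
      continuousOn_const).intervalIntegrable_of_Icc hτ.1
  · rw [uIoc_of_le hτ.1] at ht
    exact tendsto_integral_of_dominated_convergence (fun x => |ρ t x| * M)
      (fun n => (hs.integrable (hsub ht)).1.mul (hψm n t))
      ((hs.integrable (hsub ht)).abs.mul_const _) (fun n => Eventually.of_forall (hle n t ht))
      (Eventually.of_forall fun x => (hψlim t x).const_mul _)

variable {V : RegularVelocity} {w : C(ℝ, ℝ)} {ξ : ℝ → ℝ}

theorem weak_leftCutoff (hs : IsWeakSolution lam T ρ₀ u ρ) (hV : V.Transports w lam T ρ)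
    (hξ : IsChar V w ξ) {τ k : ℝ} (hτ : τ ∈ Ioc 0 T) (hξτ : ξ τ ≤ 1) (hk : 0 ≤ k) :
    (∫ t in (0 : ℝ)..τ, ∫ x, ρ t x * V.transportLeftCutoff w ξ τ k t x ∂volIoo 1)
      + (∫ t, (τ - t) * u t * Real.smoothTransition (ξ t * k) ∂volIoo τ)
      + τ * ∫ x, ρ₀ x * Real.smoothTransition ((ξ 0 - x) * k) ∂volIoo 1 = 0 := by
  refine Eq.trans ?_ (hs.weak τ (Ioc_subset_Icc_self hτ) _
    (hξ.isTestFunction_leftCutoff hξτ hk))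
  rw [← integral_volIoo hτ.1.le, ← integral_volIoo zero_le_one (fun x => ρ₀ x * _),
    ← intervalIntegral.integral_const_mul]
  congr 1
  · congr 1
    · refine intervalIntegral.integral_congr fun t ht => ?_
      rw [uIcc_of_le hτ.1.le] at ht
      rw [← integral_volIoo zero_le_one]
      refine intervalIntegral.integral_congr fun x hx => ?_
      rw [uIcc_of_le zero_le_one] at hx
      simp only [← hV.velocity_eq t ⟨ht.1, ht.2.trans hτ.2⟩ x hx,
        hξ.derivWithin_leftCutoff k hτ.1 ht hx]
    · refine intervalIntegral.integral_congr fun t _ => ?_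
      simp only [leftCutoff, sub_zero]
      ring
  · refine intervalIntegral.integral_congr fun x _ => ?_
    simp only [leftCutoff, sub_zero]
    ring

theorem integral_integral_mul_heaviside (hs : IsWeakSolution lam T ρ₀ u ρ)
    (hV : V.Transports w lam T ρ) (hρ₀ : Integrable ρ₀ (volIoo 1)) (hu : Integrable u (volIoo T))
    (hξ : IsChar V w ξ) {τ : ℝ} (hτ : τ ∈ Ioc 0 T) (hξτ : ξ τ ≤ 1) :
    ∫ t in (0 : ℝ)..τ, ∫ x, ρ t x * heaviside (ξ t - x) ∂volIoo 1
      = (∫ t in (0 : ℝ)..τ, (τ - t) * (u t * heaviside (ξ t)))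
        + τ * ∫ x, ρ₀ x * heaviside (ξ 0 - x) ∂volIoo 1 := by
  obtain ⟨M, hM⟩ := V.exists_abs_transportLeftCutoff_le w ξ (Ioc_subset_Icc_self hτ)
  have hbulk := hs.tendsto_integral_integral_mul
    (fun n : ℕ => V.continuous_transportLeftCutoff w hξ.continuous τ (n + 1))
    (fun n => hM _ (by positivity)) (V.tendsto_transportLeftCutoff w ξ τ)
    (Ioc_subset_Icc_self hτ)
  have huτ : Integrable (fun t => (τ - t) * u t) (volIoo τ) := by
    have hcont : ContinuousOn (fun t => τ - t) (uIcc 0 τ) := by fun_prop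
    have hint := ((intervalIntegrable_of_integrable_volIoo hu
      (Ioc_subset_Icc_self hτ)).continuousOn_mul hcont)
    rwa [intervalIntegrable_iff_integrableOn_Ioo_of_le hτ.1.le] at hint
  have hinflow := tendsto_integral_mul_smoothTransition huτ hξ.continuous.measurable
  have hinitial := (tendsto_integral_mul_smoothTransition (d := fun x => ξ 0 - x) hρ₀
    (measurable_const.sub measurable_id)).const_mul τ
  have hlim := tendsto_nhds_unique ((hbulk.add hinflow).add hinitial)
    (tendsto_const_nhds.congr fun n : ℕ =>
      (hs.weak_leftCutoff hV hξ hτ hξτ (k := n + 1) (by positivity)).symm)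
  rw [integral_volIoo hτ.1.le (fun t => (τ - t) * (u t * heaviside (ξ t)))]
  simp only [mul_neg, integral_neg, intervalIntegral.integral_neg, mul_assoc] at hlim
  linarith

theorem continuousOn_integral_mul_heaviside (hs : IsWeakSolution lam T ρ₀ u ρ)
    (hξ : Continuous ξ) :
    ContinuousOn (fun t => ∫ x, ρ t x * heaviside (ξ t - x) ∂volIoo 1) (Icc 0 T) := by
  refine hs.continuousOn_integral_mul (M := 1)
    (fun t => (measurable_heaviside.comp (measurable_const.sub measurable_id)).aestronglyMeasurable)
    (fun t _ x => abs_heaviside_le_one _) fun s _ => ?_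
  filter_upwards [ae_restrict_of_ae (Measure.ae_ne volume (ξ s))] with x hx
  exact (continuousAt_heaviside (sub_ne_zero.2 hx.symm)).comp (f := fun t => ξ t - x) (by fun_prop)

theorem integral_mul_heaviside (hs : IsWeakSolution lam T ρ₀ u ρ)
    (hV : V.Transports w lam T ρ) (hρ₀ : Integrable ρ₀ (volIoo 1)) (hu : Integrable u (volIoo T))
    (hξ : IsChar V w ξ) {t : ℝ} (ht : t ∈ Ioc 0 T) (hξt : ξ t ≤ 1) :
    ∫ x, ρ t x * heaviside (ξ t - x) ∂volIoo 1
      = (∫ x, ρ₀ x * heaviside (ξ 0 - x) ∂volIoo 1)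
        + ∫ s in (0 : ℝ)..t, u s * heaviside (ξ s) := by
  have hinflux : Integrable (fun s => u s * heaviside (ξ s)) (volIoo T) :=
    hu.mul_bdd (measurable_heaviside.comp hξ.continuous.measurable).aestronglyMeasurable
      (Eventually.of_forall fun s => abs_heaviside_le_one _)
  have hsub : Icc 0 t ⊆ Icc 0 T := Icc_subset_Icc_right ht.2
  have hprimitive := (continuousOn_integral_of_integrable_volIoo (ht.1.le.trans ht.2)
    hinflux).mono hsub
  refine eq_of_integral_eq ht.1 ((hs.continuousOn_integral_mul_heaviside hξ.continuous).mono hsub)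
    (g := fun τ => _ + ∫ s in (0 : ℝ)..τ, u s * heaviside (ξ s))
    (continuousOn_const.add hprimitive) fun τ hτ => ?_
  rcases hτ.1.eq_or_lt with rfl | hpos
  · simp only [intervalIntegral.integral_same]
  rw [hs.integral_integral_mul_heaviside hV hρ₀ hu hξ ⟨hpos, hτ.2.trans ht.2⟩
      ((hξ.strictMono.monotone hτ.2).trans hξt),
    integral_sub_mul_eq_integral_integral
      (intervalIntegrable_of_integrable_volIoo hinflux (hsub hτ)),
    intervalIntegral.integral_add intervalIntegrable_const
      ((hprimitive.mono (Icc_subset_Icc_right hτ.2)).intervalIntegrable_of_Icc hpos.le),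
    intervalIntegral.integral_const, smul_eq_mul, sub_zero, add_comm]

/-- The total mass as a continuous path on the line, constant outside `[0, T]`. -/
noncomputable def massPath (hs : IsWeakSolution lam T ρ₀ u ρ) (hT : 0 ≤ T) : C(ℝ, ℝ) where
  toFun := IccExtend hT ((Icc 0 T).domRestrict (totalMass ρ))
  continuous_toFun := hs.continuousOn_totalMass.domRestrict.Icc_extend'

theorem massPath_apply (hs : IsWeakSolution lam T ρ₀ u ρ) (hT : 0 ≤ T) (s : ℝ) :
    hs.massPath hT s = totalMass ρ (projIcc 0 T hT s) := rfl

theorem massPath_of_mem (hs : IsWeakSolution lam T ρ₀ u ρ) (hT : 0 ≤ T) {t : ℝ}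
    (ht : t ∈ Icc 0 T) : hs.massPath hT t = totalMass ρ t := by
  rw [massPath_apply, projIcc_of_mem _ ht]

theorem transports_massPath (hs : IsWeakSolution lam T ρ₀ u ρ) (hT : 0 ≤ T) {R : ℝ}
    (hR : ∀ t ∈ Icc 0 T, totalMass ρ t ≤ R)
    (hV : ∀ x ∈ Icc (0 : ℝ) 1, ∀ w ∈ Icc 0 R, V x w = lam x w) :
    V.Transports (hs.massPath hT) lam T ρ where
  mass_eq _ := hs.massPath_of_mem hT
  velocity_eq t ht x hx := by
    rw [hs.massPath_of_mem hT ht, hV x hx _ ⟨hs.mass_nonneg t ht, hR t ht⟩]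

end IsWeakSolution

section Primitive

/-- The primitive that vanishes at `-∞`. -/
noncomputable def primitive (g : ℝ → ℝ) (s : ℝ) : ℝ := ∫ x in Iic s, g x

variable {g g' : ℝ → ℝ}

theorem primitive_sub_primitive (hg : Integrable g) (s t : ℝ) :
    primitive g t - primitive g s = ∫ x in s..t, g x :=
  intervalIntegral.integral_Iic_sub_Iic hg.integrableOn hg.integrableOn

theorem abs_primitive_sub_le (hg : Integrable g) {K : ℝ} (hK : ∀ x, |g x| ≤ K) (s t : ℝ) :
    |primitive g t - primitive g s| ≤ K * |t - s| := by
  rw [primitive_sub_primitive hg, ← Real.norm_eq_abs]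
  exact intervalIntegral.norm_integral_le_of_norm_le_const fun x _ => hK x

theorem abs_primitive_le_integral_abs (hg : Integrable g) (s : ℝ) :
    |primitive g s| ≤ ∫ x, |g x| :=
  (norm_integral_le_integral_norm _).trans
    (setIntegral_le_integral hg.norm (Eventually.of_forall fun _ => norm_nonneg _))

theorem abs_primitive_sub_le_integral_abs (hg : Integrable g) (s t : ℝ) :
    |primitive g t - primitive g s| ≤ ∫ x, |g x| := by
  rw [primitive_sub_primitive hg]
  exact intervalIntegral.norm_integral_le_integral_norm_uIoc.trans
    (setIntegral_le_integral hg.norm (Eventually.of_forall fun _ => norm_nonneg _))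

theorem primitive_sub_eq_primitive (hg : Integrable g) (hg' : Integrable g') (s : ℝ) :
    primitive (g' - g) s = primitive g' s - primitive g s :=
  integral_sub hg'.integrableOn hg.integrableOn

theorem abs_primitive_sub_primitive_le (hg : Integrable g) (hg' : Integrable g') {K : ℝ}
    (hK : ∀ x, |g x| ≤ K) (s s' : ℝ) :
    |primitive g' s' - primitive g s| ≤ (∫ x, |(g' - g) x|) + K * |s' - s| := by
  refine (_root_.abs_sub_le _ (primitive g s') _).trans
    (add_le_add ?_ (abs_primitive_sub_le hg hK s s'))
  rw [← primitive_sub_eq_primitive hg hg']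
  exact abs_primitive_le_integral_abs (hg'.sub hg) s'

theorem primitive_eq_integral_mul_heaviside (g : ℝ → ℝ) (s : ℝ) :
    primitive g s = ∫ x, g x * heaviside (s - x) := by
  rw [primitive, integral_Iic_eq_integral_Iio, ← integral_indicator measurableSet_Iio]
  congr with x
  simp [indicator_apply, heaviside]

theorem ae_hasDerivAt_primitive (hg : Integrable g) : ∀ᵐ s, HasDerivAt (primitive g) (g s) s := by
  filter_upwards [LocallyIntegrable.ae_hasDerivAt_integral hg.locallyIntegrable] with s hs
  refine ((hs 0).const_add (primitive g 0)).congr_of_eventuallyEq (Eventually.of_forall fun t => ?_)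
  simp only [← primitive_sub_primitive hg, add_sub_cancel]

end Primitive

/-- `g` is a representative of `f` on `(0, a)` that is defined on the whole line, vanishes outside
`(0, a)` and is bounded by `K` everywhere, so that it can be composed with characteristics. -/
structure IsBoundedRep (a K : ℝ) (f g : ℝ → ℝ) : Prop where
  measurable : Measurable g
  bound : ∀ x, |g x| ≤ K
  eq_zero : ∀ x ∉ Ioo 0 a, g x = 0
  ae_eq : f =ᵐ[volIoo a] g

theorem exists_isBoundedRep {a : ℝ} {f : ℝ → ℝ} (hf : AEStronglyMeasurable f (volIoo a)) {K : ℝ≥0}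
    (hK : eLpNorm f ∞ (volIoo a) ≤ K) : ∃ g, IsBoundedRep a K f g := by
  refine ⟨(Ioo 0 a).indicator fun x => max (-K) (min K (hf.mk f x)),
    (measurable_const.max (measurable_const.min hf.stronglyMeasurable_mk.measurable)).indicator
      measurableSet_Ioo, fun x => ?_, fun x hx => indicator_of_notMem hx _, ?_⟩
  · rw [indicator_apply]
    split_ifs
    · exact abs_le.2 ⟨le_max_left _ _, max_le (by linarith [K.2]) (min_le_left _ _)⟩
    · simp
  · filter_upwards [hf.ae_eq_mk, ae_le_eLpNormEssSup (f := f) (μ := volIoo a),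
      ae_restrict_mem measurableSet_Ioo] with x hmk hess hx
    rw [← eLpNorm_exponent_top] at hess
    have hfK : |f x| ≤ K := by exact_mod_cast enorm_le_coe.1 (hess.trans hK)
    rw [indicator_of_mem hx, ← hmk, min_eq_right (abs_le.1 hfK).2, max_eq_right (abs_le.1 hfK).1]

namespace IsBoundedRep

variable {a K : ℝ} {f g f' g' : ℝ → ℝ}

theorem bound_nonneg (h : IsBoundedRep a K f g) : 0 ≤ K := (abs_nonneg _).trans (h.bound 0)

theorem integrable (h : IsBoundedRep a K f g) : Integrable g := by
  have hint : IntegrableOn g (Ioo 0 a) :=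
    (integrable_const K).mono' h.measurable.aestronglyMeasurable (Eventually.of_forall h.bound)
  exact hint.integrable_of_forall_notMem_eq_zero h.eq_zero

theorem integrable_volIoo (h : IsBoundedRep a K f g) : Integrable f (volIoo a) :=
  (integrable_congr h.ae_eq).2 h.integrable.integrableOn

theorem integral_abs_le (h : IsBoundedRep a K f g) (ha : 0 ≤ a) : ∫ x, |g x| ≤ K * a := by
  rw [← setIntegral_eq_integral_of_forall_compl_eq_zero (s := Ioo 0 a)
    (fun x hx => by rw [h.eq_zero x hx, abs_zero])]
  have hle := norm_setIntegral_le_of_norm_le_const (μ := volume) (s := Ioo 0 a)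
    (f := fun x => |g x|) (C := K) (by simp) (fun x _ => by simpa using h.bound x)
  simp only [Measure.real, Real.volume_Ioo, sub_zero, ENNReal.toReal_ofReal ha] at hle
  exact (le_abs_self _).trans hle

theorem eLpNorm_one_sub_eq (h : IsBoundedRep a K f g) (h' : IsBoundedRep a K f' g') :
    eLpNorm (g' - g) 1 volume = eLpNorm (f' - f) 1 (volIoo a) := by
  rw [eLpNorm_congr_ae (h'.ae_eq.sub h.ae_eq), volIoo,
    ← eLpNorm_indicator_eq_eLpNorm_restrict measurableSet_Ioo]
  congr
  refine (indicator_eq_self.2 (Function.support_subset_iff'.2 fun x hx => ?_)).symm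
  rw [Pi.sub_apply, h.eq_zero x hx, h'.eq_zero x hx, sub_self]

theorem primitive_eq_zero (h : IsBoundedRep a K f g) {s : ℝ} (hs : s ≤ 0) : primitive g s = 0 :=
  setIntegral_eq_zero_of_forall_eq_zero fun _ hx =>
    h.eq_zero _ fun hx' => hx'.1.not_ge (hx.trans hs)

theorem primitive_max_zero (h : IsBoundedRep a K f g) (s : ℝ) :
    primitive g (max s 0) = primitive g s := by
  rcases le_total s 0 with hs | hs
  · rw [max_eq_right hs, h.primitive_eq_zero le_rfl, h.primitive_eq_zero hs]
  · rw [max_eq_left hs]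

theorem integral_mul_heaviside (h : IsBoundedRep a K f g) (s : ℝ) :
    ∫ x, f x * heaviside (s - x) ∂volIoo a = primitive g s := by
  rw [primitive_eq_integral_mul_heaviside,
    integral_congr_ae (h.ae_eq.mono fun x hx => congrArg (· * heaviside (s - x)) hx)]
  exact setIntegral_eq_integral_of_forall_compl_eq_zero fun x hx => by simp [h.eq_zero x hx]

end IsBoundedRep

namespace RegularVelocity

variable (V : RegularVelocity) (w : C(ℝ, ℝ))

/-- The mass in `[0, x]` at time `t` when the initial density is `g₀` and the influx is `gu`: the
initial mass to the left of the foot of the characteristic through `(t, x)`, plus the mass that has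
entered since that characteristic did. -/
noncomputable def charMass (g₀ gu : ℝ → ℝ) (t x : ℝ) : ℝ :=
  primitive g₀ (V.foot w t x)
    + (primitive gu t - primitive gu (V.entryTime w (V.foot w t x)))

/-- The derivative of `charMass` in `x`, defined at every point. -/
noncomputable def charRep (g₀ gu : ℝ → ℝ) (t x : ℝ) : ℝ :=
  V.footDeriv w t x * g₀ (V.foot w t x)
    + V.footDeriv w t x / V 0 (w (V.entryTime w (V.foot w t x)))
      * gu (V.entryTime w (V.foot w t x))

/-- The out-flux of `charRep`. -/
noncomputable def charOutflux (g₀ gu : ℝ → ℝ) (t : ℝ) : ℝ := V.charRep w g₀ gu t 1 * V 1 (w t)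

variable {w} {T K : ℝ} {f₀ u g₀ gu : ℝ → ℝ}

theorem charMass_le (h₀ : IsBoundedRep 1 K f₀ g₀) (hu : IsBoundedRep T K u gu) (hT : 0 ≤ T)
    (t x : ℝ) : V.charMass w g₀ gu t x ≤ K * (1 + T) := by
  have hinitial := (le_abs_self _).trans ((abs_primitive_le_integral_abs h₀.integrable
    (V.foot w t x)).trans (h₀.integral_abs_le zero_le_one))
  have hinflow := (le_abs_self _).trans ((abs_primitive_sub_le_integral_abs hu.integrable
    (V.entryTime w (V.foot w t x)) t).trans (hu.integral_abs_le hT))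
  unfold charMass
  linarith

section Antilipschitz

theorem antilipschitzWith_entryTime :
    AntilipschitzWith V.maxSpeed.toNNReal (V.entryTime w) :=
  AntilipschitzWith.of_le_mul_dist fun σ σ' => by
    simpa only [Real.dist_eq, Real.coe_toNNReal _ V.maxSpeed_pos.le] using
      V.abs_sub_le_maxSpeed_mul_entryTime w σ σ'

theorem antilipschitzWith_foot (t : ℝ) :
    AntilipschitzWith (Real.exp (V.lipConst * |t|)).toNNReal (V.foot w t) :=
  AntilipschitzWith.of_le_mul_dist fun x y => by
    simpa only [Real.dist_eq, Real.coe_toNNReal _ (Real.exp_pos _).le] using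
      V.abs_sub_le_exp_mul_foot w t x y

theorem antilipschitzWith_foot_time (T x : ℝ) :
    AntilipschitzWith (Real.exp (V.lipConst * T) / V.minSpeed).toNNReal
      ((Ioo 0 T).domRestrict fun t => V.foot w t x) :=
  AntilipschitzWith.of_le_mul_dist fun s t => by
    have hc := V.minSpeed_pos
    rw [Real.coe_toNNReal _ (by positivity)]
    exact V.abs_sub_le_exp_div_mul_foot w x (Ioo_subset_Icc_self s.2) (Ioo_subset_Icc_self t.2)

end Antilipschitz

section Measurability

variable (w)

@[fun_prop]
theorem continuous_foot_comp {α : Type*} [TopologicalSpace α] {f g : α → ℝ} (hf : Continuous f)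
    (hg : Continuous g) : Continuous fun a => V.foot w (f a) (g a) :=
  V.continuous_foot.comp (continuous_const.prodMk (hf.prodMk hg))

@[fun_prop]
theorem continuous_footDeriv_comp {α : Type*} [TopologicalSpace α] {f g : α → ℝ}
    (hf : Continuous f) (hg : Continuous g) : Continuous fun a => V.footDeriv w (f a) (g a) :=
  V.continuous_footDeriv.comp (continuous_const.prodMk (hf.prodMk hg))

@[fun_prop]
theorem continuous_entryTime_comp {α : Type*} [TopologicalSpace α] {f : α → ℝ}
    (hf : Continuous f) : Continuous fun a => V.entryTime w (f a) :=
  (V.continuous_entryTime_apply w).comp hf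

theorem continuous_footDeriv_div :
    Continuous fun q : C(ℝ, ℝ) × ℝ × ℝ =>
      V.footDeriv q.1 q.2.1 q.2.2 / V 0 (q.1 (V.entryTime q.1 (V.foot q.1 q.2.1 q.2.2))) := by
  have hentry := V.continuous_entryTime.comp (continuous_fst.prodMk V.continuous_foot)
  exact V.continuous_footDeriv.div
    (V.continuous_comp continuous_const (continuous_eval.comp (continuous_fst.prodMk hentry)))
    fun _ => (V.pos _ _).ne'

theorem measurable_initialRep (hg₀ : Measurable g₀) :
    Measurable fun q : ℝ × ℝ => V.footDeriv w q.1 q.2 * g₀ (V.foot w q.1 q.2) :=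
  (V.continuous_footDeriv_comp w continuous_fst continuous_snd).measurable.mul
    (hg₀.comp (V.continuous_foot_comp w continuous_fst continuous_snd).measurable)

theorem measurable_inflowRep (hgu : Measurable gu) :
    Measurable fun q : ℝ × ℝ => V.footDeriv w q.1 q.2
      / V 0 (w (V.entryTime w (V.foot w q.1 q.2))) * gu (V.entryTime w (V.foot w q.1 q.2)) :=
  (V.continuous_footDeriv_div.comp (Continuous.prodMk_right w)).measurable.mul
    (hgu.comp (show Continuous fun q : ℝ × ℝ => V.entryTime w (V.foot w q.1 q.2) by
      fun_prop).measurable)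

theorem measurable_charRep (hg₀ : Measurable g₀) (hgu : Measurable gu) :
    Measurable fun q : ℝ × ℝ => V.charRep w g₀ gu q.1 q.2 :=
  (V.measurable_initialRep w hg₀).add (V.measurable_inflowRep w hgu)

theorem measurable_charRep_time (hg₀ : Measurable g₀) (hgu : Measurable gu) (x : ℝ) :
    Measurable fun t => V.charRep w g₀ gu t x :=
  (V.measurable_charRep w hg₀ hgu).comp measurable_prodMk_right

end Measurability

section Bounds

theorem footDeriv_le_of_mem_Icc {t : ℝ} (ht : t ∈ Icc 0 T) (x : ℝ) :
    V.footDeriv w t x ≤ Real.exp (V.lipConst * T) := by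
  have hL := V.lipConst_nonneg
  refine (V.footDeriv_le w t x).trans ?_
  rw [abs_of_nonneg ht.1]
  gcongr
  exact ht.2

theorem footDeriv_div_le_of_mem_Icc {t : ℝ} (ht : t ∈ Icc 0 T) (x y r : ℝ) :
    V.footDeriv w t x / V y r ≤ Real.exp (V.lipConst * T) / V.minSpeed :=
  div_le_div₀ (Real.exp_pos _).le (V.footDeriv_le_of_mem_Icc ht x) V.minSpeed_pos
    (V.minSpeed_le y r)

variable (K T) in
/-- An upper bound for `charRep` up to time `T` when the data are bounded by `K`. -/
noncomputable def densityBound : ℝ≥0 :=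
  (Real.exp (V.lipConst * T) * K + Real.exp (V.lipConst * T) / V.minSpeed * K).toNNReal

theorem abs_charRep_le (hg₀ : ∀ x, |g₀ x| ≤ K) (hgu : ∀ x, |gu x| ≤ K) {t : ℝ}
    (ht : t ∈ Icc 0 T) (x : ℝ) : |V.charRep w g₀ gu t x| ≤ V.densityBound T K := by
  refine le_trans ?_ (Real.le_coe_toNNReal _)
  have hpos := V.footDeriv_pos w t x
  refine (abs_add_le _ _).trans (add_le_add ?_ ?_)
  · rw [abs_mul, abs_of_pos hpos]
    exact mul_le_mul (V.footDeriv_le_of_mem_Icc ht x) (hg₀ _) (abs_nonneg _) (Real.exp_pos _).le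
  · rw [abs_mul, abs_of_pos (div_pos hpos (V.pos _ _))]
    exact mul_le_mul (V.footDeriv_div_le_of_mem_Icc ht x _ _) (hgu _) (abs_nonneg _)
      (div_pos (Real.exp_pos _) V.minSpeed_pos).le

theorem abs_charOutflux_le (hg₀ : ∀ x, |g₀ x| ≤ K) (hgu : ∀ x, |gu x| ≤ K) {t : ℝ}
    (ht : t ∈ Icc 0 T) :
    |V.charOutflux w g₀ gu t| ≤ V.densityBound T K * V.maxSpeed := by
  rw [charOutflux, abs_mul, abs_of_pos (V.pos _ _)]
  exact mul_le_mul (V.abs_charRep_le hg₀ hgu ht 1) (V.le_maxSpeed _ _) (V.pos _ _).le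
    (NNReal.coe_nonneg _)

end Bounds

section TimeSlice

variable (w T)

theorem map_foot_time_le (x : ℝ) : (volIoo T).map (V.foot w · x)
    ≤ (Real.exp (V.lipConst * T) / V.minSpeed).toNNReal • volume :=
  map_restrict_le_of_antilipschitzWith measurableSet_Ioo
    (show Continuous (V.foot w · x) by fun_prop).measurable (V.antilipschitzWith_foot_time T x)

theorem map_entryTime_foot_time_le (x : ℝ) : (volIoo T).map (fun t => V.entryTime w (V.foot w t x))
    ≤ ((Real.exp (V.lipConst * T) / V.minSpeed).toNNReal * V.maxSpeed.toNNReal) • volume :=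
  map_restrict_le_of_antilipschitzWith measurableSet_Ioo
    (show Continuous fun t => V.entryTime w (V.foot w t x) by fun_prop).measurable
    (V.antilipschitzWith_entryTime.comp (V.antilipschitzWith_foot_time T x))

end TimeSlice

section Convergence

variable {ι : Type*} {l : Filter ι} [l.IsCountablyGenerated] {W : ι → C(ℝ, ℝ)} {X : ι → ℝ} {x : ℝ}

theorem tendsto_eLpNorm_one_timeSlice_mul_comp_sub {a S : C(ℝ, ℝ) × ℝ × ℝ → ℝ} {M C : ℝ≥0}
    {G : ι → ℝ → ℝ} {g : ℝ → ℝ} (ha : Continuous a)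
    (haM : ∀ w x, ∀ᵐ t ∂volIoo T, |a (w, t, x)| ≤ M) (hS : Continuous S)
    (hSC : ∀ w x, (volIoo T).map (fun t => S (w, t, x)) ≤ C • volume) (hW : Tendsto W l (𝓝 w))
    (hX : Tendsto X l (𝓝 x)) (hG : ∀ n, Measurable (G n)) (hg : Integrable g)
    (hGg : Tendsto (fun n => eLpNorm (G n - g) 1) l (𝓝 0)) :
    Tendsto (fun n => eLpNorm ((fun t => a (W n, t, X n) * G n (S (W n, t, X n)))
      - fun t => a (w, t, x) * g (S (w, t, x))) 1 (volIoo T)) l (𝓝 0) := by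
  have hparam (t : ℝ) : Tendsto (fun n => (W n, t, X n)) l (𝓝 (w, t, x)) :=
    hW.prodMk_nhds (tendsto_const_nhds.prodMk_nhds hX)
  have hslice (w : C(ℝ, ℝ)) (x : ℝ) : Continuous fun t : ℝ => (w, t, x) := by fun_prop
  exact tendsto_eLpNorm_one_mul_comp_sub
    (fun n => (ha.comp (hslice (W n) (X n))).aestronglyMeasurable)
    (ha.comp (hslice w x)).aestronglyMeasurable (fun n => haM (W n) (X n)) (haM w x)
    (Eventually.of_forall fun t => (ha.tendsto _).comp (hparam t))
    (fun n => (hG n).aestronglyMeasurable) hg hGg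
    (fun n => (hS.comp (hslice (W n) (X n))).measurable) (hS.comp (hslice w x)).measurable
    (fun n => hSC (W n) (X n)) (hSC w x)
    (Eventually.of_forall fun t => (hS.tendsto _).comp (hparam t))

variable {G₀ Gu : ι → ℝ → ℝ}

theorem tendsto_eLpNorm_charRep_sub (hW : Tendsto W l (𝓝 w)) (hX : Tendsto X l (𝓝 x))
    (hG₀ : ∀ n, Measurable (G₀ n)) (hGu : ∀ n, Measurable (Gu n)) (hg₀m : Measurable g₀)
    (hgum : Measurable gu) (hg₀ : Integrable g₀) (hgu : Integrable gu)
    (h₀ : Tendsto (fun n => eLpNorm (G₀ n - g₀) 1) l (𝓝 0))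
    (hu : Tendsto (fun n => eLpNorm (Gu n - gu) 1) l (𝓝 0)) :
    Tendsto (fun n => eLpNorm ((fun t => V.charRep (W n) (G₀ n) (Gu n) t (X n))
      - fun t => V.charRep w g₀ gu t x) 1 (volIoo T)) l (𝓝 0) := by
  have hderiv_le (w : C(ℝ, ℝ)) (x : ℝ) : ∀ᵐ t ∂volIoo T,
      |V.footDeriv w t x| ≤ (Real.exp (V.lipConst * T)).toNNReal := by
    filter_upwards [ae_restrict_mem measurableSet_Ioo] with t ht
    rw [abs_of_pos (V.footDeriv_pos w t x)]
    exact (V.footDeriv_le_of_mem_Icc (Ioo_subset_Icc_self ht) x).trans (Real.le_coe_toNNReal _)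
  have hquot_le (w : C(ℝ, ℝ)) (x : ℝ) : ∀ᵐ t ∂volIoo T,
      |V.footDeriv w t x / V 0 (w (V.entryTime w (V.foot w t x)))|
        ≤ (Real.exp (V.lipConst * T) / V.minSpeed).toNNReal := by
    filter_upwards [ae_restrict_mem measurableSet_Ioo] with t ht
    rw [abs_of_pos (div_pos (V.footDeriv_pos w t x) (V.pos _ _))]
    exact (V.footDeriv_div_le_of_mem_Icc (Ioo_subset_Icc_self ht) x _ _).trans
      (Real.le_coe_toNNReal _)
  have hinitial := tendsto_eLpNorm_one_timeSlice_mul_comp_sub V.continuous_footDeriv hderiv_le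
    V.continuous_foot (fun w x => V.map_foot_time_le w T x) hW hX hG₀ hg₀ h₀
  have hinflow := tendsto_eLpNorm_one_timeSlice_mul_comp_sub V.continuous_footDeriv_div hquot_le
    (V.continuous_entryTime.comp (continuous_fst.prodMk V.continuous_foot))
    (fun w x => V.map_entryTime_foot_time_le w T x) hW hX hGu hgu hu
  have hsum := hinitial.add hinflow
  rw [add_zero] at hsum
  refine tendsto_of_tendsto_of_tendsto_of_le_of_le tendsto_const_nhds hsum (fun _ => bot_le)
    fun n => ?_
  refine le_of_eq_of_le (congrArg (eLpNorm · 1 (volIoo T)) ?_) (eLpNorm_add_le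
    ((((V.measurable_initialRep (W n) (hG₀ n)).comp measurable_prodMk_right).sub
      ((V.measurable_initialRep w hg₀m).comp measurable_prodMk_right)).aestronglyMeasurable)
    ((((V.measurable_inflowRep (W n) (hGu n)).comp measurable_prodMk_right).sub
      ((V.measurable_inflowRep w hgum).comp measurable_prodMk_right)).aestronglyMeasurable) le_rfl)
  exact funext fun t => add_sub_add_comm _ _ _ _

theorem integrable_charRep_time (hg₀ : ∀ x, |g₀ x| ≤ K) (hgu : ∀ x, |gu x| ≤ K)
    (hg₀m : Measurable g₀) (hgum : Measurable gu) (x : ℝ) :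
    Integrable (fun t => V.charRep w g₀ gu t x) (volIoo T) :=
  .of_bound (V.measurable_charRep_time w hg₀m hgum x).aestronglyMeasurable (V.densityBound T K)
    ((ae_restrict_mem measurableSet_Ioo).mono fun _ ht =>
      V.abs_charRep_le hg₀ hgu (Ioo_subset_Icc_self ht) x)

theorem tendsto_eLpNorm_charOutflux_sub (hW : Tendsto W l (𝓝 w))
    (hG₀ : ∀ n, Measurable (G₀ n)) (hGu : ∀ n, Measurable (Gu n)) (h₀ : IsBoundedRep 1 K f₀ g₀)
    (hu : IsBoundedRep T K u gu) (hlim₀ : Tendsto (fun n => eLpNorm (G₀ n - g₀) 1) l (𝓝 0))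
    (hlimu : Tendsto (fun n => eLpNorm (Gu n - gu) 1) l (𝓝 0)) :
    Tendsto (fun n => eLpNorm (V.charOutflux (W n) (G₀ n) (Gu n) - V.charOutflux w g₀ gu) 1
      (volIoo T)) l (𝓝 0) := by
  have hspeed (w : C(ℝ, ℝ)) : ∀ᵐ t ∂volIoo T, |V 1 (w t)| ≤ V.maxSpeed.toNNReal :=
    .of_forall fun t => (abs_of_pos (V.pos _ _)).trans_le
      ((V.le_maxSpeed _ _).trans (Real.le_coe_toNNReal _))
  have hcont (w : C(ℝ, ℝ)) : Continuous fun t => V 1 (w t) :=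
    V.continuous_comp continuous_const w.continuous
  have hlim (t : ℝ) : Tendsto (fun n => V 1 (W n t)) l (𝓝 (V 1 (w t))) :=
    ((hcont (.id ℝ)).tendsto (w t)).comp (((continuous_eval_const t).tendsto w).comp hW)
  have hprod := tendsto_eLpNorm_one_mul_sub (fun n => (hcont (W n)).aestronglyMeasurable)
    (hcont w).aestronglyMeasurable (fun n => hspeed (W n)) (hspeed w) (.of_forall hlim)
    (fun n => (V.measurable_charRep_time (W n) (hG₀ n) (hGu n) 1).aestronglyMeasurable)
    (V.integrable_charRep_time h₀.bound hu.bound h₀.measurable hu.measurable 1)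
    (V.tendsto_eLpNorm_charRep_sub hW tendsto_const_nhds hG₀ hGu h₀.measurable hu.measurable
      h₀.integrable hu.integrable hlim₀ hlimu)
  convert hprod using 4 <;> exact funext fun t => mul_comm _ _

end Convergence

end RegularVelocity

theorem quasiMeasurePreserving_of_antilipschitzWith {C : ℝ≥0} {S : ℝ → ℝ} (hSm : Measurable S)
    (hS : AntilipschitzWith C S) : Measure.QuasiMeasurePreserving S :=
  quasiMeasurePreserving_of_map_le hSm (C := C) <| by
    simpa only [Measure.restrict_univ] using
      map_restrict_le_of_antilipschitzWith MeasurableSet.univ hSm (hS.domRestrict univ)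

theorem integral_mul_heaviside_sub (f : ℝ → ℝ) {a x : ℝ} (hx : x ∈ Icc 0 a) :
    ∫ z, f z * heaviside (x - z) ∂volIoo a = ∫ z in (0 : ℝ)..x, f z := by
  have hind : (fun z => f z * heaviside (x - z)) = (Iio x).indicator f := by
    ext z
    simp [indicator_apply, heaviside]
  rw [hind, volIoo, setIntegral_indicator measurableSet_Iio, Ioo_inter_Iio, min_eq_right hx.2,
    ← integral_Ioc_eq_integral_Ioo, ← intervalIntegral.integral_of_le hx.1]

theorem ae_eq_prod_of_ae_ae_eq {α β γ : Type*} [MeasurableSpace α] [MeasurableSpace β]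
    [TopologicalSpace γ] [TopologicalSpace.MetrizableSpace γ] {μ : Measure α}
    {ν : Measure β} [SFinite μ] [SFinite ν] {f g : α × β → γ}
    (hf : AEStronglyMeasurable f (μ.prod ν)) (hg : AEStronglyMeasurable g (μ.prod ν))
    (h : ∀ᵐ a ∂μ, ∀ᵐ b ∂ν, f (a, b) = g (a, b)) : f =ᵐ[μ.prod ν] g := by
  have hmk : hf.mk f =ᵐ[μ.prod ν] hg.mk g := by
    refine (Measure.ae_prod_iff_ae_ae
      (hf.stronglyMeasurable_mk.measurableSet_eq_fun hg.stronglyMeasurable_mk)).2 ?_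
    filter_upwards [h, Measure.ae_ae_of_ae_prod hf.ae_eq_mk, Measure.ae_ae_of_ae_prod hg.ae_eq_mk]
      with a hfg hfmk hgmk
    filter_upwards [hfg, hfmk, hgmk] with b hfg hfmk hgmk
    rw [← hfmk, ← hgmk, hfg]
  exact hf.ae_eq_mk.trans (hmk.trans hg.ae_eq_mk.symm)

theorem volume_restrict_Ioo_prod_Ioo (a b : ℝ) :
    (volume.restrict (Ioo 0 a ×ˢ Ioo 0 b) : Measure (ℝ × ℝ)) = (volIoo a).prod (volIoo b) := by
  rw [volIoo, volIoo, Measure.prod_restrict, Measure.volume_eq_prod]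

theorem frequently_nhdsWithin_of_ae_volIoo {a x : ℝ} (ha : 0 < a) {P : ℝ → Prop}
    (hP : ∀ᵐ z ∂volIoo a, P z) (hx : x ∈ Icc 0 a) : ∃ᶠ z in 𝓝[Icc 0 a] x, P z := by
  have hdense : Dense {z | z ∈ Ioo 0 a → P z} :=
    Measure.dense_of_ae ((ae_restrict_iff' measurableSet_Ioo).1 hP)
  have hclosure : x ∈ closure (Ioo 0 a ∩ {z | z ∈ Ioo 0 a → P z}) := by
    rw [← closure_Ioo ha.ne] at hx
    exact closure_minimal (hdense.open_subset_closure_inter isOpen_Ioo) isClosed_closure hx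
  exact frequently_nhdsWithin_iff.2 ((mem_closure_iff_frequently.1 hclosure).mono fun z hz =>
    ⟨hz.2 hz.1, Ioo_subset_Icc_self hz.1⟩)

namespace IsSpaceContinuousRep

variable {T : ℝ} {ρ r r' : ℝ → ℝ → ℝ}

theorem ae_ae_eq (h : IsSpaceContinuousRep T ρ r) (h' : IsSpaceContinuousRep T ρ r') :
    ∀ᵐ x ∂volIoo 1, ∀ᵐ t ∂volIoo T, r t x = r' t x := by
  have hprod := h.ae_eq.trans h'.ae_eq.symm
  rw [volume_restrict_Ioo_prod_Ioo] at hprod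
  exact Measure.ae_ae_of_ae_prod (Measure.measurePreserving_swap.quasiMeasurePreserving.ae hprod)

theorem ae_eq_apply (h : IsSpaceContinuousRep T ρ r) (h' : IsSpaceContinuousRep T ρ r') {x : ℝ}
    (hx : x ∈ Icc (0 : ℝ) 1) : ∀ᵐ t ∂volIoo T, r t x = r' t x := by
  have hm := fun z hz => (h.memLp 1 le_rfl ENNReal.one_ne_top z hz).aestronglyMeasurable
  have hm' := fun z hz => (h'.memLp 1 le_rfl ENNReal.one_ne_top z hz).aestronglyMeasurable
  have hlim := (h.continuous_Lp 1 le_rfl ENNReal.one_ne_top x hx).add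
    (h'.continuous_Lp 1 le_rfl ENNReal.one_ne_top x hx)
  rw [add_zero] at hlim
  have hle : eLpNorm (fun t => r t x - r' t x) 1 (volIoo T) ≤ 0 := by
    refine ge_of_tendsto_of_frequently hlim (((frequently_nhdsWithin_of_ae_volIoo zero_lt_one
      (h.ae_ae_eq h') hx).and_eventually self_mem_nhdsWithin).mono fun z ⟨hrr', hz⟩ => ?_)
    have hsplit : (fun t => r t x - r' t x) =ᵐ[volIoo T]
        (fun t => r' t z - r' t x) - (fun t => r t z - r t x) := by
      filter_upwards [hrr'] with t ht
      simp only [Pi.sub_apply, ht, sub_sub_sub_cancel_left]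
    rw [eLpNorm_congr_ae hsplit, add_comm]
    exact eLpNorm_sub_le ((hm' z hz).sub (hm' x hx)) ((hm z hz).sub (hm x hx)) le_rfl
  have hzero := (eLpNorm_eq_zero_iff ((hm x hx).sub (hm' x hx)) one_ne_zero).1 (le_zero_iff.1 hle)
  filter_upwards [hzero] with t ht using sub_eq_zero.1 ht

end IsSpaceContinuousRep

theorem IsOutflux.ae_eq {lam : ℝ → ℝ → ℝ} {T : ℝ} {ρ : ℝ → ℝ → ℝ} {y z : ℝ → ℝ}
    (hy : IsOutflux lam T ρ y) (hz : IsOutflux lam T ρ z) : y =ᵐ[volIoo T] z := by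
  obtain ⟨r, hr, hyr⟩ := hy
  obtain ⟨r', hr', hzr'⟩ := hz
  filter_upwards [hyr, hzr', hr.ae_eq_apply hr' (right_mem_Icc.2 zero_le_one)]
    with t hyt hzt hrr'
  rw [hyt, hzt, hrr']

theorem IsChar.integral_influx_mul_heaviside {V : RegularVelocity} {w : C(ℝ, ℝ)} {ξ : ℝ → ℝ}
    {T K : ℝ} {u gu : ℝ → ℝ} (hξ : IsChar V w ξ) (hu : IsBoundedRep T K u gu) {t : ℝ}
    (ht : t ∈ Icc 0 T) (het : V.entryTime w (ξ 0) ≤ t) :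
    ∫ s in (0 : ℝ)..t, u s * heaviside (ξ s)
      = primitive gu t - primitive gu (V.entryTime w (ξ 0)) := by
  set e := V.entryTime w (ξ 0)
  have hae : ∀ᵐ s ∂volIoo t, u s = gu s :=
    ae_mono (Measure.restrict_mono (Ioo_subset_Ioo_right ht.2) le_rfl) hu.ae_eq
  have hind : (fun s => u s * heaviside (ξ s)) =ᵐ[volIoo t] (Ioi e).indicator gu := by
    filter_upwards [hae, ae_restrict_mem measurableSet_Ioo] with s hus hs
    simp only [heaviside, hξ.pos_iff_entryTime_lt hs.1.le, hus, indicator_apply, mem_Ioi, e,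
      mul_ite, mul_one, mul_zero]
  rw [integral_volIoo ht.1, integral_congr_ae hind, volIoo, setIntegral_indicator measurableSet_Ioi,
    Ioo_inter_Ioi, ← integral_Ioc_eq_integral_Ioo,
    ← intervalIntegral.integral_of_le (max_le ht.1 het), ← primitive_sub_primitive hu.integrable,
    max_comm, hu.primitive_max_zero]

namespace IsWeakSolution

variable {lam : ℝ → ℝ → ℝ} {T K : ℝ} {ρ₀ u : ℝ → ℝ} {ρ : ℝ → ℝ → ℝ} {V : RegularVelocity}
  {w : C(ℝ, ℝ)} {g₀ gu : ℝ → ℝ}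

theorem integral_eq_charMass (hs : IsWeakSolution lam T ρ₀ u ρ) (hV : V.Transports w lam T ρ)
    (h₀ : IsBoundedRep 1 K ρ₀ g₀) (hu : IsBoundedRep T K u gu) {t x : ℝ} (ht : t ∈ Ioc 0 T)
    (hx : x ∈ Icc (0 : ℝ) 1) : ∫ z in (0 : ℝ)..x, ρ t z = V.charMass w g₀ gu t x := by
  have hmass := hs.integral_mul_heaviside hV h₀.integrable_volIoo hu.integrable_volIoo
    (V.isChar_flow w t x) ht ((V.flow_self w t x).trans_le hx.2)
  rw [V.flow_self, integral_mul_heaviside_sub (ρ t) hx, h₀.integral_mul_heaviside,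
    (V.isChar_flow w t x).integral_influx_mul_heaviside hu (Ioc_subset_Icc_self ht)
      (V.entryTime_foot_le w ht.1.le hx.1)] at hmass
  exact hmass

theorem ae_eq_charRep_slice (hs : IsWeakSolution lam T ρ₀ u ρ) (hV : V.Transports w lam T ρ)
    (h₀ : IsBoundedRep 1 K ρ₀ g₀) (hu : IsBoundedRep T K u gu) {t : ℝ} (ht : t ∈ Ioc 0 T) :
    ∀ᵐ x ∂volIoo 1, V.charRep w g₀ gu t x = ρ t x := by
  have hfoot : Continuous (V.foot w t) := V.continuous_foot_comp w continuous_const continuous_id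
  have hinitial := (quasiMeasurePreserving_of_antilipschitzWith hfoot.measurable
    (V.antilipschitzWith_foot t)).ae (ae_hasDerivAt_primitive h₀.integrable)
  have hinflow := (quasiMeasurePreserving_of_antilipschitzWith
    ((V.continuous_entryTime_apply w).comp hfoot).measurable
    (V.antilipschitzWith_entryTime.comp (V.antilipschitzWith_foot t))).ae
      (ae_hasDerivAt_primitive hu.integrable)
  have hρ := (intervalIntegrable_of_integrable_volIoo (hs.integrable (Ioc_subset_Icc_self ht))
    (right_mem_Icc.2 zero_le_one)).ae_hasDerivAt_integral
  filter_upwards [ae_restrict_of_ae hinitial, ae_restrict_of_ae hinflow, ae_restrict_of_ae hρ,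
    ae_restrict_mem measurableSet_Ioo] with x hinitial hinflow hρ hx
  have hfoot' := V.hasDerivAt_foot (w := w) ht.1.le hx.2.le
  have hentry := (V.hasDerivAt_entryTime w (V.foot w t x)).comp x hfoot'
  have hcharMass := (hinitial.comp x hfoot').add
    ((hinflow.comp x hentry).const_sub (primitive gu t))
  have hmass : HasDerivAt (fun x => ∫ z in (0 : ℝ)..x, ρ t z) _ x :=
    hcharMass.congr_of_eventuallyEq <| by
      filter_upwards [isOpen_Ioo.mem_nhds hx] with z hz
      exact hs.integral_eq_charMass hV h₀ hu ht (Ioo_subset_Icc_self hz)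
  rw [(hρ (by rw [uIcc_of_le zero_le_one]; exact Ioo_subset_Icc_self hx) 0 left_mem_uIcc).unique
    hmass, RegularVelocity.charRep, Function.comp_apply]
  ring

theorem isSpaceContinuousRep_charRep (hs : IsWeakSolution lam T ρ₀ u ρ)
    (hV : V.Transports w lam T ρ) (h₀ : IsBoundedRep 1 K ρ₀ g₀) (hu : IsBoundedRep T K u gu) :
    IsSpaceContinuousRep T ρ (V.charRep w g₀ gu) := by
  have hbound (x : ℝ) : ∀ᵐ t ∂volIoo T, |V.charRep w g₀ gu t x| ≤ V.densityBound T K :=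
    (ae_restrict_mem measurableSet_Ioo).mono fun t ht =>
      V.abs_charRep_le h₀.bound hu.bound (Ioo_subset_Icc_self ht) x
  refine ⟨?_, fun p _ _ x _ => .of_bound (V.measurable_charRep_time w h₀.measurable hu.measurable
    x).aestronglyMeasurable _ (hbound x), fun p hp hp' x _ => ?_⟩
  · have hm := hs.memLp_top.aestronglyMeasurable
    rw [volume_restrict_Ioo_prod_Ioo] at hm ⊢
    refine ae_eq_prod_of_ae_ae_eq
      (V.measurable_charRep w h₀.measurable hu.measurable).aestronglyMeasurable hm ?_
    filter_upwards [ae_restrict_mem measurableSet_Ioo] with t ht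
    exact hs.ae_eq_charRep_slice hV h₀ hu (Ioo_subset_Ioc_self ht)
  · refine tendsto_eLpNorm_of_ae_abs_le (M := V.densityBound T K + V.densityBound T K) ?_ hp hp'
      (V.tendsto_eLpNorm_charRep_sub tendsto_const_nhds (tendsto_id.mono_left nhdsWithin_le_nhds)
        (fun _ => h₀.measurable) (fun _ => hu.measurable) h₀.measurable hu.measurable
        h₀.integrable hu.integrable (by simpa using tendsto_const_nhds)
        (by simpa using tendsto_const_nhds))
    refine .of_forall fun z => ?_
    filter_upwards [hbound z, hbound x] with t hz hx
    exact (abs_sub _ _).trans (by push_cast; exact add_le_add hz hx)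

theorem isOutflux_charOutflux (hs : IsWeakSolution lam T ρ₀ u ρ) (hV : V.Transports w lam T ρ)
    (h₀ : IsBoundedRep 1 K ρ₀ g₀) (hu : IsBoundedRep T K u gu) :
    IsOutflux lam T ρ (V.charOutflux w g₀ gu) := by
  refine ⟨_, hs.isSpaceContinuousRep_charRep hV h₀ hu, ?_⟩
  filter_upwards [ae_restrict_mem measurableSet_Ioo] with t ht
  rw [RegularVelocity.charOutflux, hV.velocity_eq t (Ioo_subset_Icc_self ht) 1
    (right_mem_Icc.2 zero_le_one)]

end IsWeakSolution

namespace IsWeakSolution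

variable {lam : ℝ → ℝ → ℝ} {T K : ℝ} {ρ₀ u g₀ gu : ℝ → ℝ} {ρ : ℝ → ℝ → ℝ}

theorem totalMass_eq_charMass {V : RegularVelocity} {w : C(ℝ, ℝ)}
    (hs : IsWeakSolution lam T ρ₀ u ρ) (hV : V.Transports w lam T ρ)
    (h₀ : IsBoundedRep 1 K ρ₀ g₀) (hu : IsBoundedRep T K u gu) {t : ℝ} (ht : t ∈ Ioc 0 T) :
    totalMass ρ t = V.charMass w g₀ gu t 1 :=
  hs.integral_eq_charMass hV h₀ hu ht (right_mem_Icc.2 zero_le_one)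

theorem totalMass_le (hs : IsWeakSolution lam T ρ₀ u ρ) (hlam : IsVelocity lam) (hT : 0 < T)
    (h₀ : IsBoundedRep 1 K ρ₀ g₀) (hu : IsBoundedRep T K u gu) {t : ℝ} (ht : t ∈ Icc 0 T) :
    totalMass ρ t ≤ K * (1 + T) := by
  obtain ⟨R, hR⟩ := isCompact_Icc.exists_bound_of_continuousOn hs.continuousOn_totalMass
  obtain ⟨V, hVlam⟩ := hlam.exists_regularVelocity
    ((norm_nonneg _).trans (hR 0 (left_mem_Icc.2 hT.le)))
  have hV := hs.transports_massPath hT.le (fun t ht => (le_abs_self _).trans (hR t ht)) hVlam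
  have hclosure := closure_Ioc hT.ne
  refine le_on_closure (s := Ioc 0 T) (fun r hr => ?_) (hclosure ▸ hs.continuousOn_totalMass)
    continuousOn_const (hclosure ▸ ht)
  rw [hs.totalMass_eq_charMass hV h₀ hu hr]
  exact V.charMass_le h₀ hu hT.le r 1

end IsWeakSolution

namespace RegularVelocity

variable (V : RegularVelocity) {w w' : C(ℝ, ℝ)} {t T : ℝ}

theorem abs_foot_sub_foot_le (ht : t ∈ Icc 0 T) (x : ℝ) :
    |V.foot w' t x - V.foot w t x|
      ≤ V.lipConst * Real.exp (V.lipConst * T) * ∫ s in (0 : ℝ)..t, |w' s - w s| := by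
  have hL := V.lipConst_nonneg
  have hJ : 0 ≤ ∫ s in (0 : ℝ)..t, |w' s - w s| :=
    intervalIntegral.integral_nonneg ht.1 fun _ _ => abs_nonneg _
  have hbound := (V.isChar_flow w' t x).abs_sub_le_mul_exp (V.isChar_flow w t x) t 0
  rw [flow_self, flow_self, sub_self, abs_zero, zero_add, intervalIntegral.integral_symm, abs_neg,
    abs_of_nonneg hJ, zero_sub, abs_neg, abs_of_nonneg ht.1, mul_right_comm] at hbound
  refine hbound.trans ?_
  gcongr
  exact ht.2

theorem abs_inletShift_sub_inletShift_le {s : ℝ} (hs : s ∈ Icc 0 t) :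
    |V.inletShift w' s - V.inletShift w s| ≤ V.lipConst * ∫ r in (0 : ℝ)..t, |w' r - w r| := by
  have hint (a : ℝ) : IntervalIntegrable (fun r => |w' r - w r|) volume 0 a :=
    Continuous.intervalIntegrable (by fun_prop) _ _
  have hVint (w : C(ℝ, ℝ)) : IntervalIntegrable (fun r => V 0 (w r)) volume 0 s :=
    (V.continuous_comp continuous_const w.continuous).intervalIntegrable _ _
  rw [inletShift, inletShift, ← intervalIntegral.integral_sub (hVint w') (hVint w),
    ← Real.norm_eq_abs]
  calc ‖∫ r in (0 : ℝ)..s, (V 0 (w' r) - V 0 (w r))‖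
      ≤ ∫ r in (0 : ℝ)..s, V.lipConst * |w' r - w r| :=
        intervalIntegral.norm_integral_le_of_norm_le hs.1 (.of_forall fun r _ => by
          simpa using V.abs_sub_le 0 (w' r) 0 (w r)) ((hint s).const_mul _)
    _ = V.lipConst * ∫ r in (0 : ℝ)..s, |w' r - w r| := intervalIntegral.integral_const_mul _ _
    _ ≤ V.lipConst * ∫ r in (0 : ℝ)..t, |w' r - w r| :=
        mul_le_mul_of_nonneg_left (intervalIntegral.integral_mono_interval le_rfl hs.1 hs.2
          (.of_forall fun _ => abs_nonneg _) (hint t)) V.lipConst_nonneg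

theorem minSpeed_mul_abs_entryTime_sub_le {σ : ℝ} (he : V.entryTime w σ ∈ Icc 0 t) (σ' : ℝ) :
    V.minSpeed * |V.entryTime w' σ' - V.entryTime w σ|
      ≤ |σ' - σ| + V.lipConst * ∫ s in (0 : ℝ)..t, |w' s - w s| := by
  set e := V.entryTime w σ
  have hsplit : V.inletShift w' (V.entryTime w' σ') - V.inletShift w' e
      = -((σ' - σ) + (V.inletShift w' e - V.inletShift w e)) := by
    rw [inletShift_entryTime, V.inletShift_entryTime w σ]
    ring
  refine ((V.isChar_inletShift w').minSpeed_mul_abs_le e (V.entryTime w' σ')).trans ?_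
  rw [hsplit, abs_neg]
  exact (abs_add_le _ _).trans (add_le_add le_rfl (V.abs_inletShift_sub_inletShift_le he))

theorem minSpeed_mul_abs_max_entryTime_sub_le {σ σ' : ℝ} (he : V.entryTime w σ ≤ t)
    (he' : V.entryTime w' σ' ≤ t) (ht : 0 ≤ t) :
    V.minSpeed * |max (V.entryTime w' σ') 0 - max (V.entryTime w σ) 0|
      ≤ |σ' - σ| + V.lipConst * ∫ s in (0 : ℝ)..t, |w' s - w s| := by
  have hmax : V.minSpeed * |max (V.entryTime w' σ') 0 - max (V.entryTime w σ) 0|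
      ≤ V.minSpeed * |V.entryTime w' σ' - V.entryTime w σ| :=
    mul_le_mul_of_nonneg_left (abs_max_sub_max_le_abs _ _ _) V.minSpeed_pos.le
  rcases le_total 0 (V.entryTime w σ) with h0 | h0
  · exact hmax.trans (V.minSpeed_mul_abs_entryTime_sub_le ⟨h0, he⟩ σ')
  rcases le_total 0 (V.entryTime w' σ') with h0' | h0'
  · refine hmax.trans ?_
    simpa only [abs_sub_comm] using V.minSpeed_mul_abs_entryTime_sub_le (w' := w) ⟨h0', he'⟩ σ
  · rw [max_eq_right h0, max_eq_right h0', sub_self, abs_zero, mul_zero]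
    exact add_nonneg (abs_nonneg _) (mul_nonneg V.lipConst_nonneg
      (intervalIntegral.integral_nonneg ht fun _ _ => abs_nonneg _))

/-- A bound up to time `T`, relative to the size of the data, on the rate at which `charMass`
responds to a change of the mass path: the first summand accounts for the displacement of the foot,
the second one for the displacement of the entry time. -/
noncomputable def massRate (T : ℝ) : ℝ :=
  V.lipConst * Real.exp (V.lipConst * T)
    + (V.lipConst * Real.exp (V.lipConst * T) + V.lipConst) / V.minSpeed

theorem massRate_nonneg (T : ℝ) : 0 ≤ V.massRate T := by
  have hL := V.lipConst_nonneg
  have hc := V.minSpeed_pos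
  unfold massRate
  positivity

theorem abs_max_entryTime_foot_sub_le (ht : t ∈ Icc 0 T) {x : ℝ} (hx : 0 ≤ x) :
    |max (V.entryTime w' (V.foot w' t x)) 0 - max (V.entryTime w (V.foot w t x)) 0|
      ≤ (V.lipConst * Real.exp (V.lipConst * T) + V.lipConst) / V.minSpeed
        * ∫ s in (0 : ℝ)..t, |w' s - w s| := by
  rw [div_mul_eq_mul_div, le_div_iff₀' V.minSpeed_pos, add_mul]
  exact (V.minSpeed_mul_abs_max_entryTime_sub_le (V.entryTime_foot_le w ht.1 hx)
    (V.entryTime_foot_le w' ht.1 hx) ht.1).trans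
      (add_le_add (V.abs_foot_sub_foot_le ht x) le_rfl)

theorem abs_charMass_sub_charMass_le {K : ℝ} {f₀ u f₀' u' g₀ gu g₀' gu' : ℝ → ℝ}
    (h₀ : IsBoundedRep 1 K f₀ g₀) (hu : IsBoundedRep T K u gu) (h₀' : IsBoundedRep 1 K f₀' g₀')
    (hu' : IsBoundedRep T K u' gu') (ht : t ∈ Icc 0 T) {x : ℝ} (hx : 0 ≤ x) :
    |V.charMass w' g₀' gu' t x - V.charMass w g₀ gu t x|
      ≤ 2 * ((∫ z, |(g₀' - g₀) z|) + ∫ s, |(gu' - gu) s|)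
        + K * V.massRate T * ∫ s in (0 : ℝ)..t, |w' s - w s| := by
  have hinitial := abs_primitive_sub_primitive_le h₀.integrable h₀'.integrable h₀.bound
    (V.foot w t x) (V.foot w' t x)
  have hinflow := abs_primitive_sub_primitive_le hu.integrable hu'.integrable hu.bound t t
  have hentry := abs_primitive_sub_primitive_le hu.integrable hu'.integrable hu.bound
    (max (V.entryTime w (V.foot w t x)) 0) (max (V.entryTime w' (V.foot w' t x)) 0)
  rw [hu.primitive_max_zero, hu'.primitive_max_zero] at hentry
  rw [sub_self, abs_zero, mul_zero, add_zero] at hinflow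
  have hfootK := mul_le_mul_of_nonneg_left (V.abs_foot_sub_foot_le (w := w) (w' := w') ht x)
    h₀.bound_nonneg
  have hentryK := mul_le_mul_of_nonneg_left
    (V.abs_max_entryTime_foot_sub_le (w := w) (w' := w') ht hx) h₀.bound_nonneg
  have hE₀ : 0 ≤ ∫ z, |(g₀' - g₀) z| := integral_nonneg fun _ => abs_nonneg _
  unfold charMass massRate
  rw [abs_le] at hinitial hinflow hentry ⊢
  constructor <;> linarith

end RegularVelocity

theorem IsWeakSolution.abs_totalMass_sub_le {V : RegularVelocity} {lam : ℝ → ℝ → ℝ} {T K : ℝ}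
    {ρ₀ u ρ₀' u' g₀ gu g₀' gu' : ℝ → ℝ} {ρ ρ' : ℝ → ℝ → ℝ} {w w' : C(ℝ, ℝ)}
    (hs : IsWeakSolution lam T ρ₀ u ρ)
    (hs' : IsWeakSolution lam T ρ₀' u' ρ') (hV : V.Transports w lam T ρ)
    (hV' : V.Transports w' lam T ρ') (h₀ : IsBoundedRep 1 K ρ₀ g₀) (hu : IsBoundedRep T K u gu)
    (h₀' : IsBoundedRep 1 K ρ₀' g₀') (hu' : IsBoundedRep T K u' gu') (hT : 0 < T) {t : ℝ}
    (ht : t ∈ Icc 0 T) :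
    |totalMass ρ' t - totalMass ρ t|
      ≤ 2 * ((∫ x, |(g₀' - g₀) x|) + ∫ s, |(gu' - gu) s|)
        * Real.exp (K * V.massRate T * T) := by
  set E := 2 * ((∫ x, |(g₀' - g₀) x|) + ∫ s, |(gu' - gu) s|)
  have : 0 ≤ E := mul_nonneg zero_le_two
    (add_nonneg (integral_nonneg fun _ => abs_nonneg _) (integral_nonneg fun _ => abs_nonneg _))
  have hrate : 0 ≤ K * V.massRate T := mul_nonneg h₀.bound_nonneg (V.massRate_nonneg T)
  have hcont : Continuous fun s => |w' s - w s| := by fun_prop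
  have hclosure := closure_Ioc hT.ne
  have hintegral (r : ℝ) (hr : r ∈ Icc 0 T) :
      |w' r - w r| ≤ E + K * V.massRate T * ∫ s in (0 : ℝ)..r, |w' s - w s| := by
    refine le_on_closure (s := Ioc 0 T) (fun r hr => ?_) hcont.continuousOn
      (((intervalIntegral.continuous_primitive (fun a b => hcont.intervalIntegrable a b)
        0).const_mul _).const_add _).continuousOn (hclosure ▸ hr)
    have hrT := Ioc_subset_Icc_self hr
    rw [hV.mass_eq r hrT, hV'.mass_eq r hrT, hs.totalMass_eq_charMass hV h₀ hu hr,
      hs'.totalMass_eq_charMass hV' h₀' hu' hr]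
    exact V.abs_charMass_sub_charMass_le h₀ hu h₀' hu' hrT zero_le_one
  rw [← hV.mass_eq t ht, ← hV'.mass_eq t ht]
  refine (le_mul_exp_of_le_add_mul_integral hcont hrate ht.1 fun r hr =>
    hintegral r ⟨hr.1, hr.2.trans ht.2⟩).trans ?_
  rw [sub_zero]
  gcongr
  exact ht.2

theorem tendsto_integral_abs_of_tendsto_eLpNorm_one {ι α : Type*} {l : Filter ι}
    [MeasurableSpace α] {μ : Measure α} {f : ι → α → ℝ}
    (hfm : ∀ n, AEStronglyMeasurable (f n) μ)
    (hf : Tendsto (fun n => eLpNorm (f n) 1 μ) l (𝓝 0)) :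
    Tendsto (fun n => ∫ x, |f n x| ∂μ) l (𝓝 0) := by
  refine ((ENNReal.tendsto_toReal ENNReal.zero_ne_top).comp hf).congr fun n => ?_
  simp only [Function.comp_apply, eLpNorm_one_eq_lintegral_enorm, ← Real.norm_eq_abs,
    integral_norm_eq_lintegral_enorm (hfm n)]

theorem tendsto_continuousMap_of_dist_le {ι : Type*} {l : Filter ι} {W : ι → C(ℝ, ℝ)} {w : C(ℝ, ℝ)}
    {D : ι → ℝ} (hW : ∀ n s, dist (W n s) (w s) ≤ D n) (hD : Tendsto D l (𝓝 0)) :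
    Tendsto W l (𝓝 w) := by
  refine ContinuousMap.tendsto_iff_tendstoLocallyUniformly.2
    (TendstoUniformly.tendstoLocallyUniformly (Metric.tendstoUniformly_iff.2 fun ε hε => ?_))
  filter_upwards [hD.eventually_lt_const hε] with n hn s
  rw [dist_comm]
  exact (hW n s).trans_lt hn

theorem IsVelocity.exists_forall_transports_massPath {lam : ℝ → ℝ → ℝ} (hlam : IsVelocity lam)
    {T : ℝ} (hT : 0 < T) {K : ℝ} (hK : 0 ≤ K) :
    ∃ V : RegularVelocity, ∀ {ρ₀ u g₀ gu : ℝ → ℝ} {ρ : ℝ → ℝ → ℝ}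
      (hs : IsWeakSolution lam T ρ₀ u ρ), IsBoundedRep 1 K ρ₀ g₀ → IsBoundedRep T K u gu →
        V.Transports (hs.massPath hT.le) lam T ρ := by
  obtain ⟨V, hVlam⟩ := hlam.exists_regularVelocity (R := K * (1 + T)) (by positivity)
  exact ⟨V, fun hs h₀ hu => hs.transports_massPath hT.le
    (fun _ ht => hs.totalMass_le hlam hT h₀ hu ht) hVlam⟩

section Outflux

variable {lam : ℝ → ℝ → ℝ} {T : ℝ} {K : ℝ≥0} {ρ₀ u : ℝ → ℝ} {ρ : ℝ → ℝ → ℝ}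

theorem IsWeakSolution.exists_isOutflux (hs : IsWeakSolution lam T ρ₀ u ρ) (hlam : IsVelocity lam)
    (hT : 0 < T) (hρ₀ : AEStronglyMeasurable ρ₀ (volIoo 1)) (hu : AEStronglyMeasurable u (volIoo T))
    (hK : eLpNorm ρ₀ ∞ (volIoo 1) + eLpNorm u ∞ (volIoo T) ≤ K) : ∃ y, IsOutflux lam T ρ y := by
  obtain ⟨g₀, h₀⟩ := exists_isBoundedRep hρ₀ (le_self_add.trans hK)
  obtain ⟨gu, hgu⟩ := exists_isBoundedRep hu (le_add_self.trans hK)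
  obtain ⟨V, hV⟩ := hlam.exists_forall_transports_massPath hT K.2
  exact ⟨_, hs.isOutflux_charOutflux (hV hs h₀ hgu) h₀ hgu⟩

theorem IsWeakSolution.tendsto_massPath {V : RegularVelocity} {g₀ gu : ℝ → ℝ}
    (hs : IsWeakSolution lam T ρ₀ u ρ) (hT : 0 < T) (hV : V.Transports (hs.massPath hT.le) lam T ρ)
    (h₀ : IsBoundedRep 1 K ρ₀ g₀) (hu : IsBoundedRep T K u gu) {ι : Type*} {l : Filter ι}
    {P₀ U G₀ Gu : ι → ℝ → ℝ} {P : ι → ℝ → ℝ → ℝ} (hS : ∀ n, IsWeakSolution lam T (P₀ n) (U n) (P n))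
    (hVS : ∀ n, V.Transports ((hS n).massPath hT.le) lam T (P n))
    (hG₀ : ∀ n, IsBoundedRep 1 K (P₀ n) (G₀ n)) (hGu : ∀ n, IsBoundedRep T K (U n) (Gu n))
    (hlim₀ : Tendsto (fun n => eLpNorm (G₀ n - g₀) 1) l (𝓝 0))
    (hlimu : Tendsto (fun n => eLpNorm (Gu n - gu) 1) l (𝓝 0)) :
    Tendsto (fun n => (hS n).massPath hT.le) l (𝓝 (hs.massPath hT.le)) := by
  have hE₀ := tendsto_integral_abs_of_tendsto_eLpNorm_one
    (fun n => ((hG₀ n).integrable.sub h₀.integrable).aestronglyMeasurable) hlim₀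
  have hEu := tendsto_integral_abs_of_tendsto_eLpNorm_one
    (fun n => ((hGu n).integrable.sub hu.integrable).aestronglyMeasurable) hlimu
  refine tendsto_continuousMap_of_dist_le (fun n s => ?_)
    (by simpa only [add_zero, mul_zero, zero_mul] using
      ((hE₀.add hEu).const_mul 2).mul_const (Real.exp (K * V.massRate T * T)))
  exact hs.abs_totalMass_sub_le (hS n) hV (hVS n) h₀ hu (hG₀ n) (hGu n) hT
    (projIcc 0 T hT.le s).2

theorem IsWeakSolution.tendsto_eLpNorm_outflux_sub (hs : IsWeakSolution lam T ρ₀ u ρ)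
    (hlam : IsVelocity lam) (hT : 0 < T) (hρ₀ : AEStronglyMeasurable ρ₀ (volIoo 1))
    (hu : AEStronglyMeasurable u (volIoo T))
    (hK : eLpNorm ρ₀ ∞ (volIoo 1) + eLpNorm u ∞ (volIoo T) ≤ K)
    {ι : Type*} {l : Filter ι} [l.IsCountablyGenerated] {P₀ U : ι → ℝ → ℝ} {P : ι → ℝ → ℝ → ℝ}
    (hS : ∀ n, IsWeakSolution lam T (P₀ n) (U n) (P n))
    (hP₀ : ∀ n, AEStronglyMeasurable (P₀ n) (volIoo 1))
    (hU : ∀ n, AEStronglyMeasurable (U n) (volIoo T))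
    (hKS : ∀ n, eLpNorm (P₀ n) ∞ (volIoo 1) + eLpNorm (U n) ∞ (volIoo T) ≤ K)
    {p : ℝ≥0∞} (hp : 1 ≤ p) (hp' : p ≠ ∞)
    (hlim₀ : Tendsto (fun n => eLpNorm (P₀ n - ρ₀) p (volIoo 1)) l (𝓝 0))
    (hlimu : Tendsto (fun n => eLpNorm (U n - u) p (volIoo T)) l (𝓝 0))
    {y : ℝ → ℝ} {Y : ι → ℝ → ℝ} (hy : IsOutflux lam T ρ y) (hY : ∀ n, IsOutflux lam T (P n) (Y n)) :
    Tendsto (fun n => eLpNorm (Y n - y) p (volIoo T)) l (𝓝 0) := by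
  obtain ⟨V, hV⟩ := hlam.exists_forall_transports_massPath hT K.2
  obtain ⟨g₀, h₀⟩ := exists_isBoundedRep hρ₀ (le_self_add.trans hK)
  obtain ⟨gu, hgu⟩ := exists_isBoundedRep hu (le_add_self.trans hK)
  choose G₀ hG₀ using fun n => exists_isBoundedRep (hP₀ n) (le_self_add.trans (hKS n))
  choose Gu hGu using fun n => exists_isBoundedRep (hU n) (le_add_self.trans (hKS n))
  have hlimG₀ : Tendsto (fun n => eLpNorm (G₀ n - g₀) 1) l (𝓝 0) := by
    simpa only [h₀.eLpNorm_one_sub_eq (hG₀ _)] using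
      tendsto_eLpNorm_one_of_tendsto_eLpNorm (fun n => (hP₀ n).sub hρ₀) hp hlim₀
  have hlimGu : Tendsto (fun n => eLpNorm (Gu n - gu) 1) l (𝓝 0) := by
    simpa only [hgu.eLpNorm_one_sub_eq (hGu _)] using
      tendsto_eLpNorm_one_of_tendsto_eLpNorm (fun n => (hU n).sub hu) hp hlimu
  have hW := hs.tendsto_massPath hT (hV hs h₀ hgu) h₀ hgu hS (fun n => hV (hS n) (hG₀ n) (hGu n))
    hG₀ hGu hlimG₀ hlimGu
  have hchar := V.tendsto_eLpNorm_charOutflux_sub hW (fun n => (hG₀ n).measurable)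
    (fun n => (hGu n).measurable) h₀ hgu hlimG₀ hlimGu
  refine (tendsto_eLpNorm_of_ae_abs_le (M := 2 * (V.densityBound T K * V.maxSpeed.toNNReal))
    (.of_forall fun n => ?_) hp hp' hchar).congr fun n => eLpNorm_congr_ae ?_
  · filter_upwards [ae_restrict_mem measurableSet_Ioo] with t ht
    have htT := Ioo_subset_Icc_self ht
    push_cast
    rw [two_mul, Real.coe_toNNReal _ V.maxSpeed_pos.le]
    exact (abs_sub _ _).trans (add_le_add
      (V.abs_charOutflux_le (hG₀ n).bound (hGu n).bound htT)
      (V.abs_charOutflux_le h₀.bound hgu.bound htT))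
  · exact (((hS n).isOutflux_charOutflux (hV (hS n) (hG₀ n) (hGu n)) (hG₀ n) (hGu n)).ae_eq
      (hY n)).sub ((hs.isOutflux_charOutflux (hV hs h₀ hgu) h₀ hgu).ae_eq hy)

theorem IsOutflux.ae_eq_of_isWeakSolution {ρ' : ℝ → ℝ → ℝ} {y y' : ℝ → ℝ}
    (hy : IsOutflux lam T ρ y) (hy' : IsOutflux lam T ρ' y') (hlam : IsVelocity lam) (hT : 0 < T)
    (hρ₀ : AEStronglyMeasurable ρ₀ (volIoo 1)) (hu : AEStronglyMeasurable u (volIoo T))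
    (hK : eLpNorm ρ₀ ∞ (volIoo 1) + eLpNorm u ∞ (volIoo T) ≤ K)
    (hs : IsWeakSolution lam T ρ₀ u ρ) (hs' : IsWeakSolution lam T ρ₀ u ρ') :
    y =ᵐ[volIoo T] y' := by
  obtain ⟨V, hV⟩ := hlam.exists_forall_transports_massPath hT K.2
  obtain ⟨g₀, h₀⟩ := exists_isBoundedRep hρ₀ (le_self_add.trans hK)
  obtain ⟨gu, hgu⟩ := exists_isBoundedRep hu (le_add_self.trans hK)
  have hmass : hs'.massPath hT.le = hs.massPath hT.le := by
    ext s
    have hle := hs.abs_totalMass_sub_le hs' (hV hs h₀ hgu) (hV hs' h₀ hgu) h₀ hgu h₀ hgu hT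
      (projIcc 0 T hT.le s).2
    simpa [IsWeakSolution.massPath_apply, sub_eq_zero] using hle
  have hchar' := hs'.isOutflux_charOutflux (hV hs' h₀ hgu) h₀ hgu
  rw [hmass] at hchar'
  exact (hy.ae_eq (hs.isOutflux_charOutflux (hV hs h₀ hgu) h₀ hgu)).trans (hchar'.ae_eq hy')

end Outflux

theorem mainTheorem3_general
    (lam : ℝ → ℝ → ℝ) (hlam : IsVelocity lam) (T : ℝ) (hT : 0 < T)
    (ρ₀ u : ℝ → ℝ) (hρ₀ : AEStronglyMeasurable ρ₀ (volIoo 1))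
    (hu : AEStronglyMeasurable u (volIoo T))
    (ε : ℝ) (hε : 0 < ε) (p : ℝ≥0∞) (hp : 1 ≤ p) (hp' : p ≠ ∞) (K : ℝ≥0)
    (hK : eLpNorm ρ₀ ∞ (volIoo 1) + eLpNorm u ∞ (volIoo T) ≤ K) :
    ∃ η : ℝ, 0 < η ∧
      ∀ ρ₀' u' : ℝ → ℝ, AEStronglyMeasurable ρ₀' (volIoo 1) →
        AEStronglyMeasurable u' (volIoo T) →
        eLpNorm ρ₀' ∞ (volIoo 1) + eLpNorm u' ∞ (volIoo T) ≤ K →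
        eLpNorm (fun x => ρ₀' x - ρ₀ x) p (volIoo 1)
          + eLpNorm (fun t => u' t - u t) p (volIoo T) < ENNReal.ofReal η →
        ∀ ρ ρ' : ℝ → ℝ → ℝ, IsWeakSolution lam T ρ₀ u ρ → IsWeakSolution lam T ρ₀' u' ρ' →
          (∃ y, IsOutflux lam T ρ y) ∧ (∃ y', IsOutflux lam T ρ' y') ∧
          ∀ y y' : ℝ → ℝ, IsOutflux lam T ρ y → IsOutflux lam T ρ' y' →
            eLpNorm (fun t => y' t - y t) p (volIoo T) < ENNReal.ofReal ε := by
  by_contra! hcon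
  choose P₀ U hP₀ hU hKS hdist R P hR hS hgap using fun n : ℕ =>
    hcon (1 / ((n : ℝ) + 1)) Nat.one_div_pos_of_nat
  choose Z Y hZ hY hge using fun n => hgap n ((hR n).exists_isOutflux hlam hT hρ₀ hu hK)
    ((hS n).exists_isOutflux hlam hT (hP₀ n) (hU n) (hKS n))
  have hη : Tendsto (fun n : ℕ => ENNReal.ofReal (1 / ((n : ℝ) + 1))) atTop (𝓝 0) := by
    simpa using ENNReal.tendsto_ofReal (tendsto_one_div_add_atTop_nhds_zero_nat (𝕜 := ℝ))
  have hlim₀ := tendsto_of_tendsto_of_tendsto_of_le_of_le tendsto_const_nhds hη (fun _ => bot_le)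
    fun n => le_self_add.trans (hdist n).le
  have hlimu := tendsto_of_tendsto_of_tendsto_of_le_of_le tendsto_const_nhds hη (fun _ => bot_le)
    fun n => le_add_self.trans (hdist n).le
  have hlim := (hR 0).tendsto_eLpNorm_outflux_sub hlam hT hρ₀ hu hK hS hP₀ hU hKS hp hp' hlim₀
    hlimu (hZ 0) hY
  refine (ge_of_tendsto' hlim fun n => ?_).not_gt (ENNReal.ofReal_pos.2 hε)
  have hZn := (hZ 0).ae_eq_of_isWeakSolution (hZ n) hlam hT hρ₀ hu hK (hR 0) (hR n)
  rw [eLpNorm_congr_ae (EventuallyEq.rfl.sub hZn)]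
  exact hge n

theorem mainTheorem3
    (lam : ℝ → ℝ → ℝ) (hlam : IsVelocity lam) (T : ℝ) (hT : 0 < T)
    (ρ₀ u : ℝ → ℝ) (hρ₀ : MemLInftyPlus 1 ρ₀) (hu : MemLInftyPlus T u)
    (ε : ℝ) (hε : 0 < ε) (p : ℝ≥0∞) (hp : 1 ≤ p) (hp' : p ≠ ∞) (K : ℝ≥0)
    (hK : eLpNorm ρ₀ ∞ (volIoo 1) + eLpNorm u ∞ (volIoo T) ≤ K) :
    ∃ η : ℝ, 0 < η ∧
      ∀ ρ₀' u' : ℝ → ℝ, MemLInftyPlus 1 ρ₀' → MemLInftyPlus T u' →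
        eLpNorm ρ₀' ∞ (volIoo 1) + eLpNorm u' ∞ (volIoo T) ≤ K →
        eLpNorm (fun x => ρ₀' x - ρ₀ x) p (volIoo 1)
          + eLpNorm (fun t => u' t - u t) p (volIoo T) < ENNReal.ofReal η →
        ∀ ρ ρ' : ℝ → ℝ → ℝ, IsWeakSolution lam T ρ₀ u ρ → IsWeakSolution lam T ρ₀' u' ρ' →
          (∃ y, IsOutflux lam T ρ y) ∧ (∃ y', IsOutflux lam T ρ' y') ∧
          ∀ y y' : ℝ → ℝ, IsOutflux lam T ρ y → IsOutflux lam T ρ' y' →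
            eLpNorm (fun t => y' t - y t) p (volIoo T) < ENNReal.ofReal ε := by
  obtain ⟨η, hη, hstable⟩ := mainTheorem3_general lam hlam T hT ρ₀ u hρ₀.memLp.aestronglyMeasurable
    hu.memLp.aestronglyMeasurable ε hε p hp hp' K hK
  exact ⟨η, hη, fun ρ₀' u' hρ₀' hu' => hstable ρ₀' u' hρ₀'.memLp.aestronglyMeasurable
    hu'.memLp.aestronglyMeasurable⟩
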